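/- Let $0<p<1$. In the Bernoulli model a series-parallel network is grown as follows. Start with a single edge, labelled $1$, from the source to the sink. In step $n\ge 2$ choose one of the $n-1$ present edges uniformly at random, say $j=(x,y)$; with probability $p$ insert a new edge $(x,y)$ labelled $n$ directly to the right of $j$ (parallel doubling), and otherwise, with probability $1-p$, replace $j$ by the two edges $(x,z)$, labelled $j$, and $(z,y)$, labelled $n$, where $z$ is a new node (serial doubling). All choices are independent. In the resulting random network of size $n$ (that is, with $n$ edges) let - $L_n$ be the length (number of edges) of a random source-to-sink path, obtained by starting at the source and choosing at each node one of its outgoing edges uniformly at random until the sink is reached; - $L_n^{[L]}$ be the length of the leftmost source-to-sink path, which takes at each node the leftmost outgoing edge; - $D_n$ be the (out-)degree of the source. For real $x$ and integer $k\ge 0$ let $\binom{x}{k}=\frac{x(x-1)\cdots(x-k+1)}{k!}$. **Theorem.** 1. For every $n\ge 1$, $L_n$ and $L_n^{[L]}$ have the same distribution. 2. For $1\le m\le n$, $$\mathbb{P}\{L_n=m\}=\sum_{j=0}^{m-1}\binom{m-1}{j}(-1)^{n+j-1}\binom{j-p(j+1)}{n-1}.$$ 3. As $n\to\infty$, $L_n/n^{1-p}$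 converges in distribution to the Mittag-Leffler distribution with parameter $1-p$. Here a probability distribution on $\mathbb{R}$ is called Mittag-Leffler with parameter $\alpha$ if, for every integer $r\ge 0$, its $r$-th moment exists and equals $r!/\Gamma(r\alpha+1)$; such a distribution exists for $\alpha=1-p$, and the convergence holds to every distribution with these moments. 4. For $1\le \ell,m\le n$, $$\mathbb{P}\{L_n=m\text{ and }D_n=\ell\}=\sum_{i=0}^{m-1}\sum_{j=0}^{\ell-1}\binom{m-1}{i}\binom{\ell-1}{j}(-1)^{n+i+j-1}\binom{(1-p)i+pj}{n-1}.$$ -/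

import Mathlib

open Filter Topology MeasureTheory

namespace SeriesParallel

/-- A plane edge-labelled directed multigraph with `n` edges, source node `0` and sink node `1`.
The edges are labelled by `Fin n` (the label `j : Fin n` is the label `j + 1` of the usual
numbering `1, …, n`), edge `j` runs from `tail j` to `head j`, and `arr` lists the edges from left
to right. -/
structure Network (n : ℕ) where
  tail : Fin n → ℕ
  head : Fin n → ℕ
  arr : List (Fin n)

namespace Network

variable {n : ℕ}

/-- The source. -/
abbrev source : ℕ := 0

/-- The sink. -/
abbrev sink : ℕ := 1

/-- The network without edges (used only as the value of the growth process at size `0`). -/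
def empty : Network 0 := ⟨Fin.elim0, Fin.elim0, []⟩

/-- The network consisting of a single edge from the source to the sink. -/
def single : Network 1 := ⟨fun _ => source, fun _ => sink, [0]⟩

/-- The left-to-right arrangement after a new edge, with the new largest label, has been inserted
directly to the right of edge `j`. -/
def insertRight (arr : List (Fin n)) (j : Fin n) : List (Fin (n + 1)) :=
  arr.flatMap fun e => if e = j then [e.castSucc, Fin.last n] else [e.castSucc]

/-- Parallel doubling of the edge `j = (x, y)`: a new edge `(x, y)` with the new label is inserted
to the right of `j`. -/
def parallel (G : Network n) (j : Fin n) : Network (n + 1) where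
  tail := Fin.snoc (α := fun _ => ℕ) G.tail (G.tail j)
  head := Fin.snoc (α := fun _ => ℕ) G.head (G.head j)
  arr := insertRight G.arr j

/-- Serial doubling of the edge `j = (x, y)`: it is replaced by `(x, z)`, which keeps the label `j`,
and `(z, y)`, which gets the new label. The new node `z` is `n + 1`; in a network grown from
`single` by doublings, the nodes present at size `n` are among `0, …, n`. -/
def serial (G : Network n) (j : Fin n) : Network (n + 1) where
  tail := Fin.snoc (α := fun _ => ℕ) G.tail (n + 1)
  head := Fin.snoc (α := fun _ => ℕ) (Function.update G.head j (n + 1)) (G.head j)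
  arr := insertRight G.arr j

/-- The outgoing edges of the node `x`. -/
def outEdges (G : Network n) (x : ℕ) : Finset (Fin n) :=
  Finset.univ.filter fun e => G.tail e = x

/-- The degree of the source. -/
def sourceDegree (G : Network n) : ℕ := (G.outEdges source).card

/-- The random walk started at node `x` that chooses one of the outgoing edges of the current node
uniformly at random until it arrives at the sink, as the list of its edges; it is cut off after `k`
edges. -/
noncomputable def randomPathFrom (G : Network n) : ℕ → ℕ → PMF (List (Fin n))
  | 0, _ => PMF.pure []
  | k + 1, x =>
    if x = sink then PMF.pure []
    else if h : (G.outEdges x).Nonempty then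
      (PMF.uniformOfFinset (G.outEdges x) h).bind fun e =>
        (G.randomPathFrom k (G.head e)).map fun w => e :: w
    else PMF.pure []

/-- The law of the random source-to-sink path. A series-parallel network has no directed cycles, so
a path in a network with `n` edges has at most `n` edges and the cut-off has no effect. -/
noncomputable def randomPath (G : Network n) : PMF (List (Fin n)) := G.randomPathFrom n source

/-- The path started at node `x` that always takes the leftmost outgoing edge of the current node
until it arrives at the sink; it is cut off after `k` edges. -/
def leftmostPathFrom (G : Network n) : ℕ → ℕ → List (Fin n)
  | 0, _ => []
  | k + 1, x =>
    if x = sink then []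
    else match G.arr.find? (fun e => G.tail e = x) with
      | none => []
      | some e => e :: G.leftmostPathFrom k (G.head e)

/-- The leftmost source-to-sink path (again the cut-off has no effect). -/
def leftmostPath (G : Network n) : List (Fin n) := G.leftmostPathFrom n source

end Network

/-- A coin that shows `true` with probability `p` and `false` with probability `1 - p`. -/
noncomputable def coin {p : ℝ} (hp : p ∈ Set.Ioo (0 : ℝ) 1) : PMF Bool :=
  PMF.ofFintype (fun b => if b then ENNReal.ofReal p else ENNReal.ofReal (1 - p)) (by
    have h0 : 0 ≤ p := hp.1.le
    have h1 : 0 ≤ 1 - p := sub_nonneg.2 hp.2.le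
    simp [← ENNReal.ofReal_add h0 h1])

/-- The law of the random network of size `n` in the Bernoulli model: start with a single edge; in
each further step choose an edge uniformly at random and double it, in a parallel way with
probability `p` and in a serial way with probability `1 - p`. (The value at `n = 0` is only a
convention.) -/
noncomputable def networkLaw {p : ℝ} (hp : p ∈ Set.Ioo (0 : ℝ) 1) : (n : ℕ) → PMF (Network n)
  | 0 => PMF.pure Network.empty
  | 1 => PMF.pure Network.single
  | n + 2 =>
    (networkLaw hp (n + 1)).bind fun G =>
      (PMF.uniformOfFintype (Fin (n + 1))).bind fun j =>
        (coin hp).map fun b => if b then G.parallel j else G.serial j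

/-- The joint law of the random network of size `n` and of a random source-to-sink path in it. -/
noncomputable def networkPathLaw {p : ℝ} (hp : p ∈ Set.Ioo (0 : ℝ) 1) (n : ℕ) :
    PMF (Network n × List (Fin n)) :=
  (networkLaw hp n).bind fun G => G.randomPath.map fun w => (G, w)

/-- The law of the length `L_n` of a random source-to-sink path. -/
noncomputable def pathLengthLaw {p : ℝ} (hp : p ∈ Set.Ioo (0 : ℝ) 1) (n : ℕ) : PMF ℕ :=
  (networkPathLaw hp n).map fun ω => ω.2.length

/-- The law of the length of the leftmost source-to-sink path. -/
noncomputable def leftmostLengthLaw {p : ℝ} (hp : p ∈ Set.Ioo (0 : ℝ) 1) (n : ℕ) : PMF ℕ :=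
  (networkLaw hp n).map fun G => G.leftmostPath.length

/-- The joint law of the length `L_n` of a random source-to-sink path and of the degree `D_n` of
the source. -/
noncomputable def lengthDegreeLaw {p : ℝ} (hp : p ∈ Set.Ioo (0 : ℝ) 1) (n : ℕ) : PMF (ℕ × ℕ) :=
  (networkPathLaw hp n).map fun ω => (ω.2.length, ω.1.sourceDegree)

/-- The law of `L_n / n ^ (1 - p)`, as a probability measure on the real line. -/
noncomputable def scaledLengthLaw {p : ℝ} (hp : p ∈ Set.Ioo (0 : ℝ) 1) (n : ℕ) :
    ProbabilityMeasure ℝ :=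
  ⟨((pathLengthLaw hp n).map fun k => (k : ℝ) / (n : ℝ) ^ (1 - p)).toMeasure, inferInstance⟩

/-- The Mittag-Leffler distribution with parameter `α`: the probability distribution on the real
line whose `r`-th moment is `r! / Γ(r α + 1)` for every integer `r ≥ 0`. -/
def IsMittagLeffler (α : ℝ) (μ : ProbabilityMeasure ℝ) : Prop :=
  ∀ r : ℕ, Integrable (fun x : ℝ => x ^ r) (μ : Measure ℝ) ∧
    ∫ x, x ^ r ∂(μ : Measure ℝ) = (r.factorial : ℝ) / Real.Gamma (r * α + 1)

end SeriesParallel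

/-! Encode the length `L` of a weighted walk from source to sink by its generating function `F`. A
serial doubling of a uniform edge lengthens the walk by one exactly when the walk uses that edge, so
summing over the `n` edges turns `X ^ L` into `(n - L) X ^ L + L X ^ (L + 1)`, that is, `F` into `n
F + (X ^ 2 - X) F'`. A parallel doubling never changes the leftmost path, since the new edge lies to
the right. For the random path, doubling a uniform outgoing edge of a fixed node `y` of degree `d`
gives the mean of `(d F + X F(head)) / (d + 1)`, which is `F` again; hence parallel doublings have
no effect on average (`sum_walkPgf_parallel`). Both lengths therefore obey the same recursion
(`lengthProb`), which is the first claim. Averaging over the edges leaving the source alone also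
keeps track of `D_n`, which gives the joint recursion `lengthDegreeProb_succ`.

The recursions are solved by an alternating binomial transform: it turns multiplication by the index
into the shift `m - 1` (`altBinomSum_index_mul`), while `(-1) ^ n * binom y n` gains the factor `(n
- y) / (n + 1)`, affine in `y`, when `n` grows.

For the limit, the rising factorials of the length are eigenfunctions of the averaged growth step,
so their means are explicit products, asymptotic to `r! n ^ (r (1 - p)) / Γ(r (1 - p) + 1)` by
Euler's limit formula. Ordinary moments have the same leading term. The scaled laws are tight, so
some limit law has these moments, which gives existence; the moments grow slowly enough for the
characteristic functions to converge, which gives the convergence to every such law. -/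

namespace SeriesParallel

/-! ### Invariants of networks grown by doublings. -/

section Growth

open Polynomial

namespace Network

variable {n : ℕ}

/-- The structural properties of the networks grown from a single edge by doublings; `r` is a
height function that decreases strictly along every edge. -/
structure IsGrown (G : Network n) (r : ℕ → ℕ) : Prop where
  tail_le : ∀ e, G.tail e ≤ n
  head_le : ∀ e, G.head e ≤ n
  height_lt : ∀ e, r (G.head e) < r (G.tail e)
  height_le : ∀ x, r x ≤ n
  out_head : ∀ e, G.head e = sink ∨ (G.outEdges (G.head e)).Nonempty
  out_source : (G.outEdges source).Nonempty
  mem_arr : ∀ e, e ∈ G.arr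

theorem mem_outEdges {G : Network n} {x : ℕ} {e : Fin n} : e ∈ G.outEdges x ↔ G.tail e = x := by
  simp [outEdges]

theorem sum_outEdges_parallel {M : Type*} [AddCommMonoid M] (G : Network n) (j : Fin n) (x : ℕ)
    (f : Fin (n + 1) → M) :
    ∑ e ∈ (G.parallel j).outEdges x, f e =
      ∑ e ∈ G.outEdges x, f e.castSucc + if G.tail j = x then f (Fin.last n) else 0 := by
  rw [outEdges, outEdges, Finset.sum_filter, Finset.sum_filter, Fin.sum_univ_castSucc]
  simp [parallel]

theorem sum_outEdges_serial {M : Type*} [AddCommMonoid M] (G : Network n) (j : Fin n) (x : ℕ)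
    (f : Fin (n + 1) → M) :
    ∑ e ∈ (G.serial j).outEdges x, f e =
      ∑ e ∈ G.outEdges x, f e.castSucc + if n + 1 = x then f (Fin.last n) else 0 := by
  rw [outEdges, outEdges, Finset.sum_filter, Finset.sum_filter, Fin.sum_univ_castSucc]
  simp [serial, eq_comm]

theorem card_outEdges_parallel (G : Network n) (j : Fin n) (x : ℕ) :
    ((G.parallel j).outEdges x).card =
      (G.outEdges x).card + if G.tail j = x then 1 else 0 := by
  simpa only [Finset.card_eq_sum_ones] using sum_outEdges_parallel G j x (fun _ => 1)

theorem card_outEdges_serial (G : Network n) (j : Fin n) (x : ℕ) :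
    ((G.serial j).outEdges x).card = (G.outEdges x).card + if n + 1 = x then 1 else 0 := by
  simpa only [Finset.card_eq_sum_ones] using sum_outEdges_serial G j x (fun _ => 1)

@[simp] theorem parallel_tail_castSucc (G : Network n) (j e : Fin n) :
    (G.parallel j).tail e.castSucc = G.tail e := by simp [parallel]

@[simp] theorem parallel_tail_last (G : Network n) (j : Fin n) :
    (G.parallel j).tail (Fin.last n) = G.tail j := by simp [parallel]

@[simp] theorem parallel_head_castSucc (G : Network n) (j e : Fin n) :
    (G.parallel j).head e.castSucc = G.head e := by simp [parallel]

@[simp] theorem parallel_head_last (G : Network n) (j : Fin n) :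
    (G.parallel j).head (Fin.last n) = G.head j := by simp [parallel]

@[simp] theorem serial_tail_castSucc (G : Network n) (j e : Fin n) :
    (G.serial j).tail e.castSucc = G.tail e := by simp [serial]

@[simp] theorem serial_tail_last (G : Network n) (j : Fin n) :
    (G.serial j).tail (Fin.last n) = n + 1 := by simp [serial]

theorem serial_head_castSucc (G : Network n) (j e : Fin n) :
    (G.serial j).head e.castSucc = if e = j then n + 1 else G.head e := by
  simp [serial, Function.update_apply]

@[simp] theorem serial_head_last (G : Network n) (j : Fin n) :
    (G.serial j).head (Fin.last n) = G.head j := by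
  simp only [serial, Fin.snoc_last]

theorem castSucc_mem_insertRight {arr : List (Fin n)} {e : Fin n} (j : Fin n) (h : e ∈ arr) :
    e.castSucc ∈ insertRight arr j := by
  refine List.mem_flatMap.2 ⟨e, h, ?_⟩
  split_ifs <;> simp

theorem last_mem_insertRight {arr : List (Fin n)} {j : Fin n} (h : j ∈ arr) :
    Fin.last n ∈ insertRight arr j :=
  List.mem_flatMap.2 ⟨j, h, by simp⟩

theorem mem_insertRight {arr : List (Fin n)} (h : ∀ e, e ∈ arr) (j : Fin n) (e : Fin (n + 1)) :
    e ∈ insertRight arr j := by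
  induction e using Fin.lastCases with
  | last => exact last_mem_insertRight (h j)
  | cast e => exact castSucc_mem_insertRight j (h e)

theorem isGrown_single : IsGrown single (fun x => if x = source then 1 else 0) where
  tail_le e := by simp [single]
  head_le e := by simp [single]
  height_lt e := by simp [single]
  height_le x := by split_ifs <;> simp
  out_head e := by simp [single]
  out_source := ⟨0, by simp [mem_outEdges, single]⟩
  mem_arr e := by simp [single, Subsingleton.elim e 0]

theorem outEdges_parallel_nonempty {G : Network n} {x : ℕ} (j : Fin n)
    (h : (G.outEdges x).Nonempty) : ((G.parallel j).outEdges x).Nonempty := by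
  obtain ⟨e, he⟩ := h
  exact ⟨e.castSucc, by simpa [mem_outEdges] using he⟩

theorem outEdges_serial_nonempty {G : Network n} {x : ℕ} (j : Fin n)
    (h : (G.outEdges x).Nonempty) : ((G.serial j).outEdges x).Nonempty := by
  obtain ⟨e, he⟩ := h
  exact ⟨e.castSucc, by simpa [mem_outEdges] using he⟩

theorem IsGrown.parallel {G : Network n} {r : ℕ → ℕ} (h : G.IsGrown r) (j : Fin n) :
    (G.parallel j).IsGrown r where
  tail_le e := by
    induction e using Fin.lastCases with
    | last => simpa using (h.tail_le j).trans n.le_succ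
    | cast e => simpa using (h.tail_le e).trans n.le_succ
  head_le e := by
    induction e using Fin.lastCases with
    | last => simpa using (h.head_le j).trans n.le_succ
    | cast e => simpa using (h.head_le e).trans n.le_succ
  height_lt e := by
    induction e using Fin.lastCases with
    | last => simpa using h.height_lt j
    | cast e => simpa using h.height_lt e
  height_le x := (h.height_le x).trans n.le_succ
  out_head e := by
    induction e using Fin.lastCases with
    | last => simpa using (h.out_head j).imp id (outEdges_parallel_nonempty j)
    | cast e => simpa using (h.out_head e).imp id (outEdges_parallel_nonempty j)
  out_source := outEdges_parallel_nonempty j h.out_source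
  mem_arr := mem_insertRight h.mem_arr j

/-- The new node takes over the height of `G.tail j`, and every old node at that height or above is
raised by one to make room for it. -/
theorem IsGrown.serial {G : Network n} {r : ℕ → ℕ} (h : G.IsGrown r) (j : Fin n) :
    (G.serial j).IsGrown (fun x => if x = n + 1 then r (G.tail j) else
      r x + if r (G.tail j) ≤ r x then 1 else 0) where
  tail_le e := by
    induction e using Fin.lastCases with
    | last => simp
    | cast e => simpa using (h.tail_le e).trans n.le_succ
  head_le e := by
    induction e using Fin.lastCases with
    | last => simpa using (h.head_le j).trans n.le_succ
    | cast e =>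
      have := h.head_le e
      rw [serial_head_castSucc]; split_ifs <;> omega
  height_lt e := by
    have hj := h.height_lt j
    induction e using Fin.lastCases with
    | last =>
      have := h.head_le j
      simp only [serial_head_last, serial_tail_last]
      grind
    | cast e =>
      have := h.head_le e
      have := h.tail_le e
      have := h.height_lt e
      simp only [serial_head_castSucc, serial_tail_castSucc]
      grind
  height_le x := by
    have := h.height_le x
    have := h.height_le (G.tail j)
    split_ifs <;> omega
  out_head e := by
    induction e using Fin.lastCases with
    | last => simpa using (h.out_head j).imp id (outEdges_serial_nonempty j)
    | cast e =>
      rw [serial_head_castSucc]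
      split_ifs with he
      · exact Or.inr ⟨Fin.last n, by simp [mem_outEdges]⟩
      · exact (h.out_head e).imp id (outEdges_serial_nonempty j)
  out_source := outEdges_serial_nonempty j h.out_source
  mem_arr := mem_insertRight h.mem_arr j

/-! ### Generating functions of weighted walks under doubling. -/

/-- The generating function of the length of the walk from the node `x` that leaves a node along
the edge `e` with weight `c e`, stopped at the sink and cut off after `k` edges. -/
noncomputable def walkPgf (G : Network n) (c : Fin n → ℝ) : ℕ → ℕ → ℝ[X]
  | 0, _ => 1
  | k + 1, x =>
    if x = sink then 1
    else ∑ e ∈ G.outEdges x, C (c e) * (X * G.walkPgf c k (G.head e))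

/-- The first-step equations of the generating function of the length of a weighted walk. -/
structure IsWalkPgf (G : Network n) (c : Fin n → ℝ) (F : ℕ → ℝ[X]) : Prop where
  at_sink : F sink = 1
  step : ∀ x, x ≠ sink → F x = ∑ e ∈ G.outEdges x, C (c e) * (X * F (G.head e))

/-- Heights drop along edges, so a walk from `x` has at most `r x` edges and a cut-off beyond that
is invisible. -/
theorem IsGrown.walkPgf_succ {G : Network n} {r : ℕ → ℕ} (h : G.IsGrown r) (c : Fin n → ℝ)
    {k x : ℕ} (hx : x = sink ∨ (G.outEdges x).Nonempty) (hk : r x ≤ k) :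
    G.walkPgf c (k + 1) x = G.walkPgf c k x := by
  induction k generalizing x with
  | zero =>
    rcases hx with rfl | ⟨e, he⟩
    · simp [walkPgf]
    · have := h.height_lt e
      rw [mem_outEdges.1 he] at this
      omega
  | succ k ih =>
    rw [walkPgf, walkPgf.eq_def G c (k + 1) x]
    dsimp only
    split_ifs with hs
    · rfl
    · refine Finset.sum_congr rfl fun e he => ?_
      have := h.height_lt e
      rw [mem_outEdges.1 he] at this
      rw [ih (h.out_head e) (by omega)]

theorem IsGrown.isWalkPgf {G : Network n} {r : ℕ → ℕ} (h : G.IsGrown r) (c : Fin n → ℝ) :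
    G.IsWalkPgf c (G.walkPgf c (n + 1)) where
  at_sink := by simp [walkPgf]
  step x hx := by
    rw [walkPgf, if_neg hx]
    refine Finset.sum_congr rfl fun e _ => ?_
    rw [h.walkPgf_succ c (h.out_head e) (h.height_le _)]

/-- Edges that lie higher than the start do not influence the walk under serial doubling. -/
theorem IsGrown.walkPgf_serial_of_height_lt {G : Network n} {r : ℕ → ℕ} (h : G.IsGrown r)
    {c : Fin n → ℝ} {F : ℕ → ℝ[X]} (hF : G.IsWalkPgf c F) {j : Fin n} {c' : Fin (n + 1) → ℝ}
    {Q : ℕ → ℝ[X]} (hQ : (G.serial j).IsWalkPgf c' Q) (hc : ∀ e : Fin n, c' e.castSucc = c e)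
    (x : ℕ) (hxn : x ≤ n) (hx : r x < r (G.tail j)) : Q x = F x := by
  induction hm : r x using Nat.strong_induction_on generalizing x with
  | _ m ih =>
    by_cases hs : x = sink
    · rw [hs, hQ.at_sink, hF.at_sink]
    rw [hQ.step x hs, hF.step x hs, sum_outEdges_serial, if_neg (by omega), add_zero]
    refine Finset.sum_congr rfl fun e he => ?_
    have hlt := h.height_lt e
    rw [mem_outEdges.1 he] at hlt
    have hej : e ≠ j := by
      rintro rfl
      rw [mem_outEdges.1 he] at hx
      omega
    rw [serial_head_castSucc, if_neg hej, hc,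
      ih _ (hm ▸ hlt) (G.head e) (h.head_le e) (by omega) rfl]

/-- The term `(X ^ 2 - X) F'` counts the edges used by the walk. In the induction on height, the
product rule for `X * F (G.head e)` separates the first edge from the rest of the walk. -/
theorem IsGrown.sum_walkPgf_serial {G : Network n} {r : ℕ → ℕ} (h : G.IsGrown r)
    {c : Fin n → ℝ} {F : ℕ → ℝ[X]} (hF : G.IsWalkPgf c F) {c' : Fin n → Fin (n + 1) → ℝ}
    {Q : Fin n → ℕ → ℝ[X]} (hQ : ∀ j, (G.serial j).IsWalkPgf (c' j) (Q j))
    (hc : ∀ j e : Fin n, c' j e.castSucc = c e) (hl : ∀ j, c' j (Fin.last n) = 1)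
    (hn : n ≠ 0) (x : ℕ) (hxn : x ≤ n) :
    ∑ j, Q j x = (n : ℝ[X]) * F x + (X ^ 2 - X) * derivative (F x) := by
  induction hm : r x using Nat.strong_induction_on generalizing x with
  | _ m ih =>
    by_cases hs : x = sink
    · simp [hs, (hQ _).at_sink, hF.at_sink]
    have hnew (j : Fin n) : Q j (n + 1) = X * Q j (G.head j) := by
      rw [(hQ j).step _ (show n + 1 ≠ 1 by omega), sum_outEdges_serial, if_pos rfl, hl,
        Finset.sum_eq_zero]
      · simp
      · intro e he
        have := h.tail_le e
        rw [mem_outEdges.1 he] at this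
        omega
    -- If `e = j`, the walk passes through the new node and pays an extra factor `X`; below `j`
    -- nothing has changed, so the correction is `(X - 1) * F (G.head e)`.
    have key (j : Fin n) : Q j x = ∑ e ∈ G.outEdges x, C (c e) *
        (X * (Q j (G.head e) + if e = j then (X - 1) * F (G.head e) else 0)) := by
      rw [(hQ j).step x hs, sum_outEdges_serial, if_neg (by omega), add_zero]
      refine Finset.sum_congr rfl fun e he => ?_
      rw [serial_head_castSucc, hc]
      split_ifs with hej
      · subst hej
        rw [hnew, h.walkPgf_serial_of_height_lt hF (hQ e) (hc e) _ (h.head_le e)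
          (h.height_lt e)]
        ring
      · rw [add_zero]
    simp only [key]
    rw [Finset.sum_comm, hF.step x hs, derivative_sum, Finset.mul_sum, Finset.mul_sum,
      ← Finset.sum_add_distrib]
    refine Finset.sum_congr rfl fun e he => ?_
    have hlt := h.height_lt e
    rw [mem_outEdges.1 he, hm] at hlt
    rw [← Finset.mul_sum, ← Finset.mul_sum, Finset.sum_add_distrib,
      ih _ hlt _ (h.head_le e) rfl]
    simp only [Finset.sum_ite_eq, Finset.mem_univ, if_true, derivative_mul, derivative_C,
      derivative_X]
    ring

/-- The weights of the random path. -/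
noncomputable def uniformWeight (G : Network n) (e : Fin n) : ℝ :=
  ((G.outEdges (G.tail e)).card : ℝ)⁻¹

theorem IsGrown.walkPgf_parallel_of_height_lt {G : Network n} {r : ℕ → ℕ} (h : G.IsGrown r)
    {F : ℕ → ℝ[X]} (hF : G.IsWalkPgf G.uniformWeight F) {j : Fin n}
    {R : ℕ → ℝ[X]} (hR : (G.parallel j).IsWalkPgf (G.parallel j).uniformWeight R)
    (x : ℕ) (hx : r x < r (G.tail j)) : R x = F x := by
  induction hm : r x using Nat.strong_induction_on generalizing x with
  | _ m ih =>
    by_cases hs : x = sink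
    · rw [hs, hR.at_sink, hF.at_sink]
    have hjx : G.tail j ≠ x := by rintro rfl; omega
    rw [hR.step x hs, hF.step x hs, sum_outEdges_parallel, if_neg hjx, add_zero]
    refine Finset.sum_congr rfl fun e he => ?_
    have hlt := h.height_lt e
    rw [mem_outEdges.1 he] at hlt
    rw [parallel_head_castSucc, ih _ (hm ▸ hlt) (G.head e) (by omega) rfl, uniformWeight,
      uniformWeight, parallel_tail_castSucc, card_outEdges_parallel, mem_outEdges.1 he,
      if_neg hjx, add_zero]

/-- Doubling a uniform outgoing edge of `y` makes the next edge, up to identifying the two copies,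
still uniform on average, as in a Pólya urn. Only the mean over the edges leaving `y` is preserved,
not each summand. -/
theorem IsGrown.sum_walkPgf_parallel {G : Network n} {r : ℕ → ℕ} (h : G.IsGrown r)
    {F : ℕ → ℝ[X]} (hF : G.IsWalkPgf G.uniformWeight F)
    {R : Fin n → ℕ → ℝ[X]}
    (hR : ∀ j, (G.parallel j).IsWalkPgf (G.parallel j).uniformWeight (R j)) (y x : ℕ) :
    ∑ j ∈ G.outEdges y, R j x = ((G.outEdges y).card : ℝ[X]) * F x := by
  induction hm : r x using Nat.strong_induction_on generalizing x with
  | _ m ih =>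
    by_cases hs : x = sink
    · simp [hs, (hR _).at_sink, hF.at_sink]
    by_cases hxy : x = y
    · subst hxy
      have hfx : C ((G.outEdges x).card : ℝ) * F x = ∑ e ∈ G.outEdges x, X * F (G.head e) := by
        rw [hF.step x hs, Finset.mul_sum]
        refine Finset.sum_congr rfl fun e he => ?_
        have hpos : ((G.outEdges x).card : ℝ) ≠ 0 := by
          exact_mod_cast (Finset.card_pos.2 ⟨e, he⟩).ne'
        rw [uniformWeight, mem_outEdges.1 he, ← mul_assoc, ← C_mul, mul_inv_cancel₀ hpos, C_1,
          one_mul]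
      -- The old edges contribute `d * F x` and the copy of `j` contributes one more `X * F (G.head
      -- j)`, each edge now with weight `1 / (d + 1)`. Everything lower than `x` is unchanged.
      have key : ∀ j ∈ G.outEdges x, R j x = C (((G.outEdges x).card : ℝ) + 1)⁻¹ *
          (C ((G.outEdges x).card : ℝ) * F x + X * F (G.head j)) := by
        intro j hj
        have hjx := mem_outEdges.1 hj
        rw [(hR j).step x hs, sum_outEdges_parallel, if_pos hjx, hfx, mul_add, Finset.mul_sum]
        congr 1
        · refine Finset.sum_congr rfl fun e he => ?_
          have hlt := h.height_lt e
          rw [mem_outEdges.1 he] at hlt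
          rw [parallel_head_castSucc, h.walkPgf_parallel_of_height_lt hF (hR j) _ (hjx ▸ hlt),
            uniformWeight, parallel_tail_castSucc, card_outEdges_parallel, mem_outEdges.1 he,
            if_pos hjx, Nat.cast_add, Nat.cast_one]
        · have hlt := h.height_lt j
          rw [parallel_head_last, h.walkPgf_parallel_of_height_lt hF (hR j) _ hlt,
            uniformWeight, parallel_tail_last, card_outEdges_parallel, hjx,
            if_pos rfl, Nat.cast_add, Nat.cast_one]
      rw [Finset.sum_congr rfl key, ← Finset.mul_sum, Finset.sum_add_distrib, ← hfx,
        Finset.sum_const, nsmul_eq_mul]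
      have hd : (C (((G.outEdges x).card : ℝ) + 1)⁻¹ : ℝ[X]) *
          (((G.outEdges x).card : ℝ[X]) + 1) = 1 := by
        have : (((G.outEdges x).card : ℝ[X]) + 1) = C (((G.outEdges x).card : ℝ) + 1) := by simp
        rw [this, ← C_mul, inv_mul_cancel₀ (by positivity), C_1]
      simp only [map_natCast] at hd ⊢
      linear_combination ((G.outEdges x).card : ℝ[X]) * F x * hd
    · have key : ∀ j ∈ G.outEdges y, R j x = ∑ e ∈ G.outEdges x, C (G.uniformWeight e) *
          (X * R j (G.head e)) := by
        intro j hj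
        have hjx : G.tail j ≠ x := fun hj' => hxy (hj'.symm.trans (mem_outEdges.1 hj))
        rw [(hR j).step x hs, sum_outEdges_parallel, if_neg hjx, add_zero]
        refine Finset.sum_congr rfl fun e he => ?_
        rw [parallel_head_castSucc, uniformWeight, uniformWeight, parallel_tail_castSucc,
          card_outEdges_parallel, mem_outEdges.1 he, if_neg hjx, add_zero]
      rw [Finset.sum_congr rfl key, Finset.sum_comm, hF.step x hs, Finset.mul_sum]
      refine Finset.sum_congr rfl fun e he => ?_
      have hlt := h.height_lt e
      rw [mem_outEdges.1 he, hm] at hlt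
      rw [← Finset.mul_sum, ← Finset.mul_sum, ih _ hlt _ rfl]
      ring

/-! ### The leftmost path, and the path laws in terms of generating functions. -/

/-- The weights of the leftmost path. -/
def leftmostWeight (G : Network n) (e : Fin n) : ℝ :=
  if G.arr.find? (fun e' => G.tail e' = G.tail e) = some e then 1 else 0

/-- The new label stands just after `j` and satisfies `P'` only if `j` satisfies `P`, so `j` or an
earlier entry is always found before it. -/
theorem find?_insertRight (arr : List (Fin n)) (j : Fin n) {P : Fin n → Bool}
    {P' : Fin (n + 1) → Bool} (h : ∀ e : Fin n, P' e.castSucc = P e)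
    (hl : P' (Fin.last n) = true → P j = true) :
    (insertRight arr j).find? P' = (arr.find? P).map Fin.castSucc := by
  induction arr with
  | nil => simp [insertRight]
  | cons a l ih =>
    rw [insertRight, List.flatMap_cons, List.find?_append, ← insertRight, ih, List.find?_cons]
    by_cases haj : a = j
    · subst haj
      cases hP : P a
      · have : P' (Fin.last n) = false := by
          by_contra hne
          simp [hl (by simpa using hne)] at hP
        simp [h, hP, this]
      · simp [h, hP]
    · cases hP : P a <;> simp [haj, h, hP]

theorem find?_arr_parallel (G : Network n) (j : Fin n) (x : ℕ) :
    (G.parallel j).arr.find? (fun e => (G.parallel j).tail e = x) =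
      (G.arr.find? (fun e => G.tail e = x)).map Fin.castSucc :=
  find?_insertRight _ _ (by simp) (by simp)

theorem find?_arr_serial (G : Network n) (j : Fin n) {x : ℕ} (hx : x ≠ n + 1) :
    (G.serial j).arr.find? (fun e => (G.serial j).tail e = x) =
      (G.arr.find? (fun e => G.tail e = x)).map Fin.castSucc :=
  find?_insertRight _ _ (by simp) (by simp [hx.symm])

theorem map_castSucc_eq_some_castSucc {o : Option (Fin n)} {e : Fin n} :
    o.map Fin.castSucc = some e.castSucc ↔ o = some e := by
  cases o <;> simp

theorem map_castSucc_ne_some_last (o : Option (Fin n)) :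
    o.map Fin.castSucc ≠ some (Fin.last n) := by
  cases o <;> simp [Fin.castSucc_ne_last]

theorem leftmostWeight_parallel_castSucc (G : Network n) (j e : Fin n) :
    (G.parallel j).leftmostWeight e.castSucc = G.leftmostWeight e := by
  simp only [leftmostWeight, find?_arr_parallel, parallel_tail_castSucc,
    map_castSucc_eq_some_castSucc]

theorem leftmostWeight_parallel_last (G : Network n) (j : Fin n) :
    (G.parallel j).leftmostWeight (Fin.last n) = 0 := by
  rw [leftmostWeight, find?_arr_parallel, if_neg (map_castSucc_ne_some_last _)]

theorem IsGrown.leftmostWeight_serial_castSucc {G : Network n} {r : ℕ → ℕ} (h : G.IsGrown r)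
    (j e : Fin n) : (G.serial j).leftmostWeight e.castSucc = G.leftmostWeight e := by
  have := h.tail_le e
  rw [leftmostWeight, serial_tail_castSucc, find?_arr_serial _ _ (by omega), leftmostWeight]
  simp only [map_castSucc_eq_some_castSucc]

theorem IsGrown.leftmostWeight_serial_last {G : Network n} {r : ℕ → ℕ} (h : G.IsGrown r)
    (j : Fin n) : (G.serial j).leftmostWeight (Fin.last n) = 1 := by
  rw [leftmostWeight, if_pos]
  obtain ⟨e, he⟩ : ∃ e, (G.serial j).arr.find?
      (fun e' => (G.serial j).tail e' = (G.serial j).tail (Fin.last n)) = some e := by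
    rw [← Option.isSome_iff_exists, List.find?_isSome]
    exact ⟨_, (h.serial j).mem_arr (Fin.last n), by simp⟩
  have hp := List.find?_some he
  rw [he]
  induction e using Fin.lastCases with
  | last => rfl
  | cast e =>
    have := h.tail_le e
    simp at hp
    omega

theorem IsGrown.uniformWeight_serial_castSucc {G : Network n} {r : ℕ → ℕ} (h : G.IsGrown r)
    (j e : Fin n) : (G.serial j).uniformWeight e.castSucc = G.uniformWeight e := by
  have := h.tail_le e
  rw [uniformWeight, serial_tail_castSucc, card_outEdges_serial, if_neg (by omega), add_zero,
    uniformWeight]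

theorem IsGrown.uniformWeight_serial_last {G : Network n} {r : ℕ → ℕ} (h : G.IsGrown r)
    (j : Fin n) : (G.serial j).uniformWeight (Fin.last n) = 1 := by
  rw [uniformWeight, serial_tail_last, card_outEdges_serial, if_pos rfl, Finset.card_eq_zero.2]
  · simp
  · refine Finset.eq_empty_of_forall_notMem fun e he => ?_
    have := h.tail_le e
    rw [mem_outEdges.1 he] at this
    omega

theorem IsGrown.walkPgf_leftmost_parallel {G : Network n} {r : ℕ → ℕ} (h : G.IsGrown r)
    {F : ℕ → ℝ[X]} (hF : G.IsWalkPgf G.leftmostWeight F) {j : Fin n}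
    {R : ℕ → ℝ[X]} (hR : (G.parallel j).IsWalkPgf (G.parallel j).leftmostWeight R) (x : ℕ) :
    R x = F x := by
  induction hm : r x using Nat.strong_induction_on generalizing x with
  | _ m ih =>
    by_cases hs : x = sink
    · rw [hs, hR.at_sink, hF.at_sink]
    rw [hR.step x hs, hF.step x hs, sum_outEdges_parallel, leftmostWeight_parallel_last, C_0,
      zero_mul, ite_self, add_zero]
    refine Finset.sum_congr rfl fun e he => ?_
    have hlt := h.height_lt e
    rw [mem_outEdges.1 he, hm] at hlt
    rw [parallel_head_castSucc, ih _ hlt (G.head e) rfl, leftmostWeight_parallel_castSucc]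

/-- The generating function of the length of the random source-to-sink path. -/
noncomputable def randomPgf (G : Network n) : ℝ[X] := G.walkPgf G.uniformWeight (n + 1) source

/-- The generating function of the length of the leftmost source-to-sink path. -/
noncomputable def leftmostPgf (G : Network n) : ℝ[X] :=
  G.walkPgf G.leftmostWeight (n + 1) source

theorem randomPgf_single : single.randomPgf = X := by
  have h := isGrown_single.isWalkPgf single.uniformWeight
  rw [randomPgf, h.step _ (by simp)]
  simp [outEdges, single, walkPgf, uniformWeight, Finset.filter_true_of_mem]

theorem leftmostPgf_single : single.leftmostPgf = X := by
  have h := isGrown_single.isWalkPgf single.leftmostWeight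
  rw [leftmostPgf, h.step _ (by simp)]
  simp [outEdges, single, walkPgf, leftmostWeight, Finset.filter_true_of_mem]

theorem IsGrown.sum_randomPgf_serial {G : Network n} {r : ℕ → ℕ} (h : G.IsGrown r)
    (hn : n ≠ 0) : ∑ j, (G.serial j).randomPgf =
      (n : ℝ[X]) * G.randomPgf + (X ^ 2 - X) * derivative G.randomPgf :=
  h.sum_walkPgf_serial (h.isWalkPgf _) (fun j => (h.serial j).isWalkPgf _)
    h.uniformWeight_serial_castSucc h.uniformWeight_serial_last hn _ n.zero_le

theorem IsGrown.sum_leftmostPgf_serial {G : Network n} {r : ℕ → ℕ} (h : G.IsGrown r)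
    (hn : n ≠ 0) : ∑ j, (G.serial j).leftmostPgf =
      (n : ℝ[X]) * G.leftmostPgf + (X ^ 2 - X) * derivative G.leftmostPgf :=
  h.sum_walkPgf_serial (h.isWalkPgf _) (fun j => (h.serial j).isWalkPgf _)
    h.leftmostWeight_serial_castSucc h.leftmostWeight_serial_last hn _ n.zero_le

theorem IsGrown.sum_randomPgf_parallel {G : Network n} {r : ℕ → ℕ} (h : G.IsGrown r) (y : ℕ) :
    ∑ j ∈ G.outEdges y, (G.parallel j).randomPgf = ((G.outEdges y).card : ℝ[X]) * G.randomPgf :=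
  h.sum_walkPgf_parallel (h.isWalkPgf _) (fun j => (h.parallel j).isWalkPgf _) y _

theorem IsGrown.leftmostPgf_parallel {G : Network n} {r : ℕ → ℕ} (h : G.IsGrown r) (j : Fin n) :
    (G.parallel j).leftmostPgf = G.leftmostPgf :=
  h.walkPgf_leftmost_parallel (h.isWalkPgf _) ((h.parallel j).isWalkPgf _) _

/-- The condition `hx` excludes dead ends other than the sink, where the random walk stops with mass
one but the empty sum in `walkPgf` is zero. -/
theorem IsGrown.randomPathFrom_length {G : Network n} {r : ℕ → ℕ} (h : G.IsGrown r) (k x : ℕ)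
    (hx : x = sink ∨ (G.outEdges x).Nonempty) (m : ℕ) :
    (((G.randomPathFrom k x).map List.length) m).toReal =
      (G.walkPgf G.uniformWeight k x).coeff m := by
  induction k generalizing x m with
  | zero =>
    simp only [randomPathFrom, walkPgf, PMF.pure_map, PMF.pure_apply, coeff_one]
    split_ifs <;> simp_all
  | succ k ih =>
    rw [randomPathFrom, walkPgf]
    split_ifs with hs hne
    · simp only [PMF.pure_map, PMF.pure_apply, coeff_one]
      split_ifs <;> simp_all
    · rw [PMF.map_bind, PMF.bind_apply, tsum_fintype, finsetSum_coeff,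
        ENNReal.toReal_sum (fun e _ => ENNReal.mul_ne_top (PMF.apply_ne_top _ _)
          (PMF.apply_ne_top _ _)), ← Finset.sum_subset (Finset.subset_univ (G.outEdges x))]
      · refine Finset.sum_congr rfl fun e he => ?_
        rw [ENNReal.toReal_mul, PMF.uniformOfFinset_apply_of_mem _ he, coeff_C_mul, uniformWeight,
          mem_outEdges.1 he, ENNReal.toReal_inv, ENNReal.toReal_natCast, PMF.map_comp]
        congr 1
        have hcomp : (List.length ∘ fun w : List (Fin n) => e :: w) = Nat.succ ∘ List.length := by
          ext w; simp
        rw [hcomp, ← PMF.map_comp]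
        cases m with
        | zero => simp [PMF.map_apply]
        | succ m =>
          rw [coeff_X_mul, ← ih _ (h.out_head e), PMF.map_apply]
          simp
      · intro e _ he
        rw [PMF.uniformOfFinset_apply_of_notMem _ he]
        simp
    · simp_all

theorem IsGrown.randomPath_length {G : Network n} {r : ℕ → ℕ} (h : G.IsGrown r) (m : ℕ) :
    ((G.randomPath.map List.length) m).toReal = G.randomPgf.coeff m := by
  rw [randomPath, h.randomPathFrom_length _ _ (Or.inr h.out_source), randomPgf,
    h.walkPgf_succ _ (Or.inr h.out_source) (h.height_le _)]

theorem IsGrown.walkPgf_leftmostWeight {G : Network n} {r : ℕ → ℕ} (h : G.IsGrown r) (k x : ℕ)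
    (hx : x = sink ∨ (G.outEdges x).Nonempty) :
    G.walkPgf G.leftmostWeight k x = X ^ (G.leftmostPathFrom k x).length := by
  induction k generalizing x with
  | zero => simp [walkPgf, leftmostPathFrom]
  | succ k ih =>
    rw [walkPgf, leftmostPathFrom]
    split_ifs with hs
    · simp
    · obtain ⟨e, he⟩ : ∃ e, G.arr.find? (fun e' => G.tail e' = x) = some e := by
        obtain ⟨e, he⟩ := hx.resolve_left hs
        rw [← Option.isSome_iff_exists, List.find?_isSome]
        exact ⟨e, h.mem_arr e, by simpa [mem_outEdges] using he⟩
      have hex : G.tail e = x := by simpa using List.find?_some he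
      rw [he, Finset.sum_eq_single_of_mem e (mem_outEdges.2 hex)]
      · rw [leftmostWeight, hex, if_pos he, ih _ (h.out_head e)]
        simp [pow_succ']
      · intro e' he' hne
        rw [leftmostWeight, mem_outEdges.1 he', he, if_neg (by simpa using hne.symm)]
        simp

theorem IsGrown.leftmostPgf_eq {G : Network n} {r : ℕ → ℕ} (h : G.IsGrown r) :
    G.leftmostPgf = X ^ G.leftmostPath.length := by
  rw [leftmostPath, ← h.walkPgf_leftmostWeight _ _ (Or.inr h.out_source), leftmostPgf,
    h.walkPgf_succ _ (Or.inr h.out_source) (h.height_le _)]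

end Network

/-! ### Averages over all edges, with the source degree. -/

namespace Network

variable {n : ℕ}

theorem sourceDegree_single : single.sourceDegree = 1 := by
  simp [sourceDegree, outEdges, single]

theorem sourceDegree_parallel (G : Network n) (j : Fin n) :
    (G.parallel j).sourceDegree = G.sourceDegree + if G.tail j = source then 1 else 0 :=
  card_outEdges_parallel G j source

theorem sourceDegree_serial (G : Network n) (j : Fin n) :
    (G.serial j).sourceDegree = G.sourceDegree := by
  rw [sourceDegree, card_outEdges_serial, if_neg (by simp), add_zero, sourceDegree]

theorem IsGrown.sum_randomPgf_parallel_univ {G : Network n} {r : ℕ → ℕ} (h : G.IsGrown r) :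
    ∑ j, (G.parallel j).randomPgf = (n : ℝ[X]) * G.randomPgf := by
  have hmaps : ∀ j ∈ (Finset.univ : Finset (Fin n)), G.tail j ∈ Finset.range (n + 1) :=
    fun j _ => Finset.mem_range.2 (Nat.lt_succ_of_le (h.tail_le j))
  rw [← Finset.sum_fiberwise_of_maps_to hmaps]
  have hcard := Finset.card_eq_sum_card_fiberwise hmaps
  rw [Finset.card_univ, Fintype.card_fin] at hcard
  have hcast : (n : ℝ[X]) =
      ∑ y ∈ Finset.range (n + 1), ((Finset.univ.filter fun j => G.tail j = y).card : ℝ[X]) := by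
    exact_mod_cast congrArg (Nat.cast : ℕ → ℝ[X]) hcard
  rw [hcast, Finset.sum_mul]
  exact Finset.sum_congr rfl fun y _ => h.sum_randomPgf_parallel y

/-- The degree grows exactly when `j` leaves the source, and the mean over these edges alone already
preserves `randomPgf`. So in the mean the length and the increment of `ψ` decouple. -/
theorem IsGrown.sum_coeff_randomPgf_parallel {G : Network n} {r : ℕ → ℕ} (h : G.IsGrown r)
    (ψ : ℕ → ℝ) (m : ℕ) :
    ∑ j, (G.parallel j).randomPgf.coeff m * ψ (G.parallel j).sourceDegree =
      G.randomPgf.coeff m * (n * ψ G.sourceDegree +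
        G.sourceDegree * (ψ (G.sourceDegree + 1) - ψ G.sourceDegree)) := by
  have h1 := congrArg (fun P => coeff P m) h.sum_randomPgf_parallel_univ
  have h2 := congrArg (fun P => coeff P m) (h.sum_randomPgf_parallel source)
  simp only [finsetSum_coeff, ← C_eq_natCast, coeff_C_mul] at h1 h2
  have key (j : Fin n) : (G.parallel j).randomPgf.coeff m * ψ (G.parallel j).sourceDegree =
      (G.parallel j).randomPgf.coeff m * ψ G.sourceDegree +
      if G.tail j = source then
        (G.parallel j).randomPgf.coeff m * (ψ (G.sourceDegree + 1) - ψ G.sourceDegree) else 0 := by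
    rw [sourceDegree_parallel]
    split_ifs
    · ring
    · rw [add_zero, add_zero]
  simp only [key]
  rw [Finset.sum_add_distrib, ← Finset.sum_filter, ← Finset.sum_mul, ← Finset.sum_mul, h1]
  rw [outEdges] at h2
  rw [h2, sourceDegree, outEdges]
  ring

theorem coeff_zero_mul_add_mul_derivative (P : ℝ[X]) :
    ((n : ℝ[X]) * P + (X ^ 2 - X) * derivative P).coeff 0 = n * P.coeff 0 := by
  simp [mul_coeff_zero]

theorem coeff_succ_mul_add_mul_derivative (P : ℝ[X]) (m : ℕ) :
    ((n : ℝ[X]) * P + (X ^ 2 - X) * derivative P).coeff (m + 1) =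
      (n - (m + 1)) * P.coeff (m + 1) + m * P.coeff m := by
  rw [← C_eq_natCast, coeff_add, coeff_C_mul, sub_mul, coeff_sub, pow_two, mul_assoc, coeff_X_mul,
    coeff_X_mul, coeff_derivative]
  cases m with
  | zero => simp; ring
  | succ m => rw [coeff_X_mul, coeff_derivative]; push_cast; ring

end Network

/-! ### Expectations along the growth and the recursions for the laws. -/

/-- The expectation of a function of the random network of size `n + 1`. -/
noncomputable def networkMean (p : ℝ) : (n : ℕ) → (Network (n + 1) → ℝ) → ℝ
  | 0, φ => φ Network.single
  | n + 1, φ => networkMean p n fun G =>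
      ((n : ℝ) + 1)⁻¹ * ∑ j, (p * φ (G.parallel j) + (1 - p) * φ (G.serial j))

/-- Doublings preserve `IsGrown`, so the structural invariants may be assumed under every
expectation. -/
theorem networkMean_congr (p : ℝ) {n : ℕ} {φ χ : Network (n + 1) → ℝ}
    (h : ∀ G r, G.IsGrown r → φ G = χ G) : networkMean p n φ = networkMean p n χ := by
  induction n with
  | zero => exact h _ _ Network.isGrown_single
  | succ n ih =>
    refine ih fun G r hG => ?_
    simp only [h _ _ (hG.parallel _), h _ _ (hG.serial _)]

theorem networkMean_add (p : ℝ) {n : ℕ} (φ χ : Network (n + 1) → ℝ) :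
    networkMean p n (fun G => φ G + χ G) = networkMean p n φ + networkMean p n χ := by
  induction n with
  | zero => rfl
  | succ n ih =>
    rw [networkMean, networkMean, networkMean, ← ih]
    refine networkMean_congr p fun G r _ => ?_
    rw [← mul_add, ← Finset.sum_add_distrib]
    congr 1
    exact Finset.sum_congr rfl fun j _ => by ring

theorem networkMean_const_mul (p : ℝ) {n : ℕ} (a : ℝ) (φ : Network (n + 1) → ℝ) :
    networkMean p n (fun G => a * φ G) = a * networkMean p n φ := by
  induction n with
  | zero => rfl
  | succ n ih =>
    rw [networkMean, networkMean, ← ih]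
    refine networkMean_congr p fun G r _ => ?_
    rw [mul_left_comm, Finset.mul_sum _ _ a]
    congr 1
    exact Finset.sum_congr rfl fun j _ => by ring

theorem networkLaw_bind_apply {p : ℝ} (hp : p ∈ Set.Ioo (0 : ℝ) 1) {β : Type*} (n : ℕ)
    (f : Network (n + 1) → PMF β) (b : β) :
    (((networkLaw hp (n + 1)).bind f) b).toReal = networkMean p n fun G => (f G b).toReal := by
  induction n with
  | zero =>
    rw [networkLaw, PMF.pure_bind, networkMean]
  | succ n ih =>
    rw [networkLaw, PMF.bind_bind, ih, networkMean]
    refine networkMean_congr p fun G r _ => ?_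
    rw [PMF.bind_bind, PMF.bind_apply, tsum_fintype,
      ENNReal.toReal_sum (fun e _ => ENNReal.mul_ne_top (PMF.apply_ne_top _ _)
        (PMF.apply_ne_top _ _)), Finset.mul_sum]
    refine Finset.sum_congr rfl fun j _ => ?_
    rw [ENNReal.toReal_mul, PMF.uniformOfFintype_apply, Fintype.card_fin, ENNReal.toReal_inv,
      ENNReal.toReal_natCast, Nat.cast_succ, PMF.bind_map, PMF.bind_apply, tsum_fintype,
      Fintype.sum_bool, ENNReal.toReal_add
        (ENNReal.mul_ne_top (PMF.apply_ne_top _ _) (PMF.apply_ne_top _ _))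
        (ENNReal.mul_ne_top (PMF.apply_ne_top _ _) (PMF.apply_ne_top _ _)),
      ENNReal.toReal_mul, ENNReal.toReal_mul]
    simp [coin, ENNReal.toReal_ofReal hp.1.le, ENNReal.toReal_ofReal (sub_nonneg.2 hp.2.le)]

theorem networkMean_succ_randomPgf (p : ℝ) (n m : ℕ) (ψ : ℕ → ℝ) :
    networkMean p (n + 1) (fun G => G.randomPgf.coeff (m + 1) * ψ G.sourceDegree) =
      networkMean p n fun G =>
        G.randomPgf.coeff (m + 1) * ψ G.sourceDegree +
        (-((1 - p) * (m + 1) / (n + 1)) * (G.randomPgf.coeff (m + 1) * ψ G.sourceDegree) +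
        ((1 - p) * m / (n + 1) * (G.randomPgf.coeff m * ψ G.sourceDegree) +
        p / (n + 1) * (G.randomPgf.coeff (m + 1) *
          (G.sourceDegree * (ψ (G.sourceDegree + 1) - ψ G.sourceDegree))))) := by
  rw [networkMean]
  refine networkMean_congr p fun G r hG => ?_
  have h1 := hG.sum_coeff_randomPgf_parallel ψ (m + 1)
  have h2 := congrArg (fun P => coeff P (m + 1)) (hG.sum_randomPgf_serial n.succ_ne_zero)
  simp only [finsetSum_coeff, Network.coeff_succ_mul_add_mul_derivative] at h2
  simp only [Network.sourceDegree_serial]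
  rw [Finset.sum_add_distrib, ← Finset.mul_sum, ← Finset.mul_sum, ← Finset.sum_mul, h1, h2]
  push_cast
  field_simp
  ring

/-- The probability that a source-to-sink path in the random network of size `n + 1` has
length `m`. -/
noncomputable def lengthProb (p : ℝ) : ℕ → ℕ → ℝ
  | 0, m => if m = 1 then 1 else 0
  | _ + 1, 0 => 0
  | n + 1, m + 1 => (1 - (1 - p) * (m + 1) / (n + 1)) * lengthProb p n (m + 1) +
      (1 - p) * m / (n + 1) * lengthProb p n m

theorem lengthProb_zero_right (p : ℝ) (n : ℕ) : lengthProb p n 0 = 0 := by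
  cases n <;> simp [lengthProb]

theorem networkMean_randomPgf_coeff (p : ℝ) (n m : ℕ) :
    networkMean p n (fun G => G.randomPgf.coeff m) = lengthProb p n m := by
  induction n generalizing m with
  | zero => simp [networkMean, Network.randomPgf_single, coeff_X, lengthProb, eq_comm]
  | succ n ih =>
    cases m with
    | zero =>
      -- Zero is rewritten as the mean coefficient at the previous size, and one growth step
      -- preserves the coefficient of `X ^ 0`.
      rw [lengthProb_zero_right, ← lengthProb_zero_right p n, ← ih, networkMean]
      refine networkMean_congr p fun G r hG => ?_
      have h1 := congrArg (fun P => coeff P 0) hG.sum_randomPgf_parallel_univ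
      have h2 := congrArg (fun P => coeff P 0) (hG.sum_randomPgf_serial n.succ_ne_zero)
      simp only [finsetSum_coeff, Network.coeff_zero_mul_add_mul_derivative] at h2
      simp only [finsetSum_coeff, ← C_eq_natCast, coeff_C_mul] at h1
      rw [Finset.sum_add_distrib, ← Finset.mul_sum, ← Finset.mul_sum, h1, h2]
      push_cast
      field_simp
      ring
    | succ m =>
      have h := networkMean_succ_randomPgf p n m (fun _ => 1)
      simp only [mul_one, sub_self, mul_zero, add_zero] at h
      rw [h, networkMean_add, networkMean_add, networkMean_const_mul, networkMean_const_mul, ih, ih,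
        lengthProb]
      ring

theorem networkMean_leftmostPgf_coeff (p : ℝ) (n m : ℕ) :
    networkMean p n (fun G => G.leftmostPgf.coeff m) = lengthProb p n m := by
  induction n generalizing m with
  | zero => simp [networkMean, Network.leftmostPgf_single, coeff_X, lengthProb, eq_comm]
  | succ n ih =>
    rw [networkMean]
    cases m with
    | zero =>
      rw [lengthProb_zero_right, ← lengthProb_zero_right p n, ← ih]
      refine networkMean_congr p fun G r hG => ?_
      have h2 := congrArg (fun P => coeff P 0) (hG.sum_leftmostPgf_serial n.succ_ne_zero)
      simp only [finsetSum_coeff, Network.coeff_zero_mul_add_mul_derivative] at h2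
      simp only [hG.leftmostPgf_parallel]
      rw [Finset.sum_add_distrib, ← Finset.mul_sum _ _ (1 - p), h2]
      simp
      field_simp
      ring
    | succ m =>
      rw [lengthProb, ← ih, ← ih, ← networkMean_const_mul, ← networkMean_const_mul,
        ← networkMean_add]
      refine networkMean_congr p fun G r hG => ?_
      have h2 := congrArg (fun P => coeff P (m + 1)) (hG.sum_leftmostPgf_serial n.succ_ne_zero)
      simp only [finsetSum_coeff, Network.coeff_succ_mul_add_mul_derivative] at h2
      simp only [hG.leftmostPgf_parallel]
      rw [Finset.sum_add_distrib, ← Finset.mul_sum _ _ (1 - p), h2]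
      simp
      field_simp
      ring

theorem pathLengthLaw_eq {p : ℝ} (hp : p ∈ Set.Ioo (0 : ℝ) 1) (n : ℕ) :
    pathLengthLaw hp n = (networkLaw hp n).bind fun G => G.randomPath.map List.length := by
  rw [pathLengthLaw, networkPathLaw, PMF.map_bind]
  simp only [PMF.map_comp]
  rfl

theorem lengthDegreeLaw_eq {p : ℝ} (hp : p ∈ Set.Ioo (0 : ℝ) 1) (n : ℕ) :
    lengthDegreeLaw hp n = (networkLaw hp n).bind fun G =>
      (G.randomPath.map List.length).map fun k => (k, G.sourceDegree) := by
  rw [lengthDegreeLaw, networkPathLaw, PMF.map_bind]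
  simp only [PMF.map_comp]
  rfl

theorem pathLengthLaw_toReal {p : ℝ} (hp : p ∈ Set.Ioo (0 : ℝ) 1) (n m : ℕ) :
    (pathLengthLaw hp (n + 1) m).toReal = lengthProb p n m := by
  rw [pathLengthLaw_eq, networkLaw_bind_apply, ← networkMean_randomPgf_coeff]
  exact networkMean_congr p fun G r hG => hG.randomPath_length m

theorem leftmostLengthLaw_toReal {p : ℝ} (hp : p ∈ Set.Ioo (0 : ℝ) 1) (n m : ℕ) :
    (leftmostLengthLaw hp (n + 1) m).toReal = lengthProb p n m := by
  rw [leftmostLengthLaw, ← PMF.bind_pure_comp, networkLaw_bind_apply,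
    ← networkMean_leftmostPgf_coeff]
  refine networkMean_congr p fun G r hG => ?_
  rw [hG.leftmostPgf_eq, coeff_X_pow, Function.comp_apply, PMF.pure_apply]
  split_ifs <;> simp

theorem pathLengthLaw_eq_leftmostLengthLaw {p : ℝ} (hp : p ∈ Set.Ioo (0 : ℝ) 1) (n : ℕ) :
    pathLengthLaw hp (n + 1) = leftmostLengthLaw hp (n + 1) := by
  ext m
  rw [← ENNReal.toReal_eq_toReal_iff' (PMF.apply_ne_top _ _) (PMF.apply_ne_top _ _),
    pathLengthLaw_toReal, leftmostLengthLaw_toReal]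

/-- The joint probability that a random source-to-sink path in the random network of size `n + 1`
has length `m` and that the source has degree `l`. -/
noncomputable def lengthDegreeProb (p : ℝ) (n m l : ℕ) : ℝ :=
  networkMean p n fun G => G.randomPgf.coeff m * if G.sourceDegree = l then 1 else 0

theorem lengthDegreeProb_zero (p : ℝ) (m l : ℕ) :
    lengthDegreeProb p 0 m l = (if m = 1 then 1 else 0) * if l = 1 then 1 else 0 := by
  rw [lengthDegreeProb, networkMean, Network.randomPgf_single, coeff_X,
    Network.sourceDegree_single]
  simp only [eq_comm]

theorem lengthDegreeProb_succ (p : ℝ) (n m l : ℕ) :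
    lengthDegreeProb p (n + 1) (m + 1) (l + 1) =
      (1 - ((1 - p) * (m + 1) + p * (l + 1)) / (n + 1)) * lengthDegreeProb p n (m + 1) (l + 1) +
      (1 - p) * m / (n + 1) * lengthDegreeProb p n m (l + 1) +
      p * l / (n + 1) * lengthDegreeProb p n (m + 1) l := by
  have h := networkMean_succ_randomPgf p n m (fun d => if d = l + 1 then 1 else 0)
  rw [lengthDegreeProb, h, lengthDegreeProb, lengthDegreeProb, lengthDegreeProb]
  simp only [← networkMean_const_mul, ← networkMean_add]
  refine networkMean_congr p fun G r _ => ?_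
  simp only [add_left_inj]
  by_cases h1 : G.sourceDegree = l + 1
  · simp [h1]; ring
  · by_cases h2 : G.sourceDegree = l
    · simp [h2]; ring
    · simp [h1, h2]

theorem lengthDegreeLaw_toReal {p : ℝ} (hp : p ∈ Set.Ioo (0 : ℝ) 1) (n m l : ℕ) :
    (lengthDegreeLaw hp (n + 1) (m, l)).toReal = lengthDegreeProb p n m l := by
  rw [lengthDegreeLaw_eq, networkLaw_bind_apply]
  refine networkMean_congr p fun G r hG => ?_
  rw [← hG.randomPath_length, PMF.map_apply]
  split_ifs with h
  · rw [tsum_eq_single m] <;> simp +contextual [h, eq_comm]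
  · simp [Ne.symm h]

/-! ### Solving the recursions by binomial transforms. -/

/-- The alternating binomial transform. -/
def altBinomSum (m : ℕ) (h : ℕ → ℝ) : ℝ :=
  ∑ i ∈ Finset.range (m + 1), (m.choose i : ℝ) * (-1) ^ i * h i

theorem altBinomSum_add (m : ℕ) (h k : ℕ → ℝ) :
    altBinomSum m (fun i => h i + k i) = altBinomSum m h + altBinomSum m k := by
  simp only [altBinomSum, mul_add, Finset.sum_add_distrib]

theorem altBinomSum_const_mul (m : ℕ) (a : ℝ) (h : ℕ → ℝ) :
    altBinomSum m (fun i => a * h i) = a * altBinomSum m h := by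
  simp only [altBinomSum, Finset.mul_sum]
  exact Finset.sum_congr rfl fun i _ => by ring

/-- This rests on `i * binom m i = m * (binom m i - binom (m - 1) i)`. The truncated `m - 1` at `m =
0` is harmless because of the factor `m`. -/
theorem altBinomSum_index_mul (m : ℕ) (h : ℕ → ℝ) :
    altBinomSum m (fun i => i * h i) = m * (altBinomSum m h - altBinomSum (m - 1) h) := by
  cases m with
  | zero => simp [altBinomSum]
  | succ m =>
    have hext : altBinomSum m h =
        ∑ i ∈ Finset.range (m + 1 + 1), (m.choose i : ℝ) * (-1) ^ i * h i := by
      rw [Finset.sum_range_succ, Nat.choose_succ_self]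
      simp [altBinomSum]
    rw [Nat.add_sub_cancel, hext, altBinomSum, altBinomSum, ← Finset.sum_sub_distrib,
      Finset.mul_sum]
    refine Finset.sum_congr rfl fun i _ => ?_
    have key : ((m + 1).choose i : ℝ) * i =
        ((m + 1 : ℕ) : ℝ) * ((m + 1).choose i - m.choose i) := by
      cases i with
      | zero => simp
      | succ i =>
        have h1 : ((m + 1 : ℕ) : ℝ) * m.choose i = (m + 1).choose (i + 1) * ((i + 1 : ℕ) : ℝ) := by
          exact_mod_cast Nat.add_one_mul_choose_eq m i
        have h2 : ((m + 1).choose (i + 1) : ℝ) = m.choose i + m.choose (i + 1) := by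
          exact_mod_cast Nat.choose_succ_succ m i
        rw [← h1]
        rw [h2]
        ring
    linear_combination (-1) ^ i * h i * key

theorem altBinomSum_const (m : ℕ) (a : ℝ) :
    altBinomSum m (fun _ => a) = if m = 0 then a else 0 := by
  have h := add_pow (-1 : ℝ) 1 m
  simp only [neg_add_cancel, one_pow, mul_one] at h
  rw [altBinomSum, ← Finset.sum_mul]
  have h' : ∑ i ∈ Finset.range (m + 1), (m.choose i : ℝ) * (-1) ^ i = 0 ^ m := by
    rw [h]
    exact Finset.sum_congr rfl fun i _ => by ring
  rw [h', zero_pow_eq]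
  split_ifs <;> simp

/-- `(-1) ^ n * binom y n`. -/
noncomputable def signedChoose (n : ℕ) (y : ℝ) : ℝ := (-1) ^ n * Ring.choose y n

theorem signedChoose_zero (y : ℝ) : signedChoose 0 y = 1 := by
  simp [signedChoose]

theorem signedChoose_succ (n : ℕ) (y : ℝ) :
    signedChoose (n + 1) y = (n - y) / (n + 1) * signedChoose n y := by
  rw [signedChoose, signedChoose, Ring.choose_eq_smul, Ring.choose_eq_smul,
    descPochhammer_succ_right, Nat.factorial_succ]
  simp only [Polynomial.smeval_mul, Polynomial.smeval_sub, Polynomial.smeval_X,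
    Polynomial.smeval_natCast, smul_eq_mul, nsmul_eq_mul, pow_one, pow_zero, mul_one]
  have : (n.factorial : ℝ) ≠ 0 := by positivity
  push_cast
  field_simp
  ring

/-- With `y = j - p * (j + 1)`, the factor `n - y` is `(n + p) - (1 - p) * j`; transforming the
multiplication by `j` yields the recursion of `lengthProb`. At size one the transform of the
constant `1` is concentrated at `m = 0`. -/
theorem lengthProb_succ_eq (p : ℝ) (n m : ℕ) :
    lengthProb p n (m + 1) =
      altBinomSum m (fun j => signedChoose n (j - p * (j + 1))) := by
  induction n generalizing m with
  | zero =>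
    simp only [signedChoose_zero, altBinomSum_const]
    simp [lengthProb]
  | succ n ih =>
    have hn : (n : ℝ) + 1 ≠ 0 := by positivity
    have key : (fun j : ℕ => signedChoose (n + 1) (j - p * (j + 1))) = fun j : ℕ =>
        ((n + p) / (n + 1)) * signedChoose n (j - p * (j + 1)) +
          (-(1 - p) / (n + 1)) * (j * signedChoose n (j - p * (j + 1))) := by
      ext j
      rw [signedChoose_succ]
      field_simp
      ring
    rw [key, altBinomSum_add, altBinomSum_const_mul, altBinomSum_const_mul, altBinomSum_index_mul,
      lengthProb, ih]
    cases m with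
    | zero => field_simp; simp; ring
    | succ m =>
      rw [ih]
      simp only [Nat.add_sub_cancel]
      field_simp
      push_cast
      ring

theorem lengthDegreeProb_succ_eq (p : ℝ) (n m l : ℕ) :
    lengthDegreeProb p n (m + 1) (l + 1) =
      altBinomSum m (fun i => altBinomSum l (fun j =>
        signedChoose n ((1 - p) * i + p * j))) := by
  induction n generalizing m l with
  | zero =>
    simp only [signedChoose_zero, altBinomSum_const, lengthDegreeProb_zero]
    split_ifs <;> simp_all
  | succ n ih =>
    have hn : (n : ℝ) + 1 ≠ 0 := by positivity
    have key : ∀ i : ℕ, (fun j : ℕ => signedChoose (n + 1) ((1 - p) * i + p * j)) =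
        fun j : ℕ => (n / (n + 1) + (-(1 - p) / (n + 1)) * i) *
            signedChoose n ((1 - p) * i + p * j) +
          (-p / (n + 1)) * (j * signedChoose n ((1 - p) * i + p * j)) := by
      intro i
      ext j
      rw [signedChoose_succ]
      field_simp
      ring
    -- The inner transform absorbs the factor `j`; the factor `i` remains for the outer one.
    have key2 : (fun i : ℕ => altBinomSum l (fun j =>
          signedChoose (n + 1) ((1 - p) * i + p * j))) = fun i : ℕ =>
        (n - p * l) / (n + 1) * altBinomSum l (fun j => signedChoose n ((1 - p) * i + p * j)) +
        ((-(1 - p) / (n + 1)) *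
          (i * altBinomSum l (fun j => signedChoose n ((1 - p) * i + p * j))) +
        (p * l / (n + 1)) *
          altBinomSum (l - 1) (fun j => signedChoose n ((1 - p) * i + p * j))) := by
      ext i
      rw [key, altBinomSum_add, altBinomSum_const_mul, altBinomSum_const_mul,
        altBinomSum_index_mul]
      field_simp
      ring
    rw [key2, altBinomSum_add, altBinomSum_add, altBinomSum_const_mul, altBinomSum_const_mul,
      altBinomSum_const_mul, altBinomSum_index_mul, lengthDegreeProb_succ, ih]
    cases m with
    | zero =>
      cases l with
      | zero => field_simp; simp; ring
      | succ l =>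
        rw [ih]
        simp only [Nat.add_sub_cancel]
        field_simp
        simp
        ring
    | succ m =>
      cases l with
      | zero =>
        rw [ih]
        simp only [Nat.add_sub_cancel]
        field_simp
        simp
        ring
      | succ l =>
        rw [ih, ih]
        simp only [Nat.add_sub_cancel]
        field_simp
        push_cast
        ring

theorem pathLengthLaw_toReal_eq_sum {p : ℝ} (hp : p ∈ Set.Ioo (0 : ℝ) 1) (n m : ℕ) (hm : 1 ≤ m)
    (hmn : m ≤ n) :
    (pathLengthLaw hp n m).toReal =
      ∑ j ∈ Finset.range m, ((m - 1).choose j : ℝ) * (-1) ^ (n + j - 1) *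
        Ring.choose ((j : ℝ) - p * ((j : ℝ) + 1)) (n - 1) := by
  obtain ⟨m, rfl⟩ := Nat.exists_eq_add_of_le' hm
  obtain ⟨n, rfl⟩ := Nat.exists_eq_add_of_le' (hm.trans hmn)
  rw [pathLengthLaw_toReal, lengthProb_succ_eq, altBinomSum]
  refine Finset.sum_congr rfl fun j _ => ?_
  rw [signedChoose, show n + 1 + j - 1 = n + j by omega, pow_add, Nat.add_sub_cancel,
    Nat.add_sub_cancel]
  ring

theorem lengthDegreeLaw_toReal_eq_sum {p : ℝ} (hp : p ∈ Set.Ioo (0 : ℝ) 1) (n m l : ℕ)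
    (hm : 1 ≤ m) (hmn : m ≤ n) (hl : 1 ≤ l) :
    (lengthDegreeLaw hp n (m, l)).toReal =
      ∑ i ∈ Finset.range m, ∑ j ∈ Finset.range l,
        ((m - 1).choose i : ℝ) * ((l - 1).choose j : ℝ) * (-1) ^ (n + i + j - 1) *
          Ring.choose ((1 - p) * (i : ℝ) + p * (j : ℝ)) (n - 1) := by
  obtain ⟨m, rfl⟩ := Nat.exists_eq_add_of_le' hm
  obtain ⟨l, rfl⟩ := Nat.exists_eq_add_of_le' hl
  obtain ⟨n, rfl⟩ := Nat.exists_eq_add_of_le' (hm.trans hmn)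
  rw [lengthDegreeLaw_toReal, lengthDegreeProb_succ_eq, altBinomSum]
  refine Finset.sum_congr rfl fun i _ => ?_
  rw [altBinomSum, Finset.mul_sum]
  refine Finset.sum_congr rfl fun j _ => ?_
  rw [signedChoose, show n + 1 + i + j - 1 = n + i + j by omega, pow_add, pow_add,
    Nat.add_sub_cancel, Nat.add_sub_cancel, Nat.add_sub_cancel]
  ring

end Growth

/-! ### The method of moments: convergence, and existence of a limit. -/

section MethodOfMoments

/-- The Taylor bound for the exponential function on the imaginary axis. -/
theorem norm_exp_sub_sum_le_of_re_eq_zero {a : ℂ} (ha : a.re = 0) (N : ℕ) {y : ℝ} (hy : 0 ≤ y) :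
    ‖Complex.exp (a * y) - ∑ k ∈ Finset.range N, (a * y) ^ k / (k.factorial : ℂ)‖ ≤
      (‖a‖ * y) ^ N / N.factorial := by
  induction N generalizing y with
  | zero => simp [Complex.norm_exp, ha]
  | succ N ih =>
    have hd : ∀ x : ℝ, HasDerivAt
        (fun y : ℝ => Complex.exp (a * y) -
          ∑ k ∈ Finset.range (N + 1), (a * y) ^ k / (k.factorial : ℂ))
        (a * (Complex.exp (a * x) - ∑ k ∈ Finset.range N, (a * x) ^ k / (k.factorial : ℂ))) x := by
      intro x
      have hlin : HasDerivAt (fun y : ℝ => a * (y : ℂ)) a x := by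
        simpa using (Complex.ofRealCLM.hasDerivAt (x := x)).const_mul a
      have hsum : HasDerivAt
          (fun y : ℝ => ∑ k ∈ Finset.range (N + 1), (a * (y : ℂ)) ^ k / (k.factorial : ℂ))
          (∑ k ∈ Finset.range (N + 1),
            ((k : ℂ) * (a * (x : ℂ)) ^ (k - 1) * a) / (k.factorial : ℂ)) x :=
        HasDerivAt.fun_sum fun k _ => (hlin.fun_pow k).div_const _
      convert! hlin.cexp.sub hsum using 1
      rw [Finset.sum_range_succ', mul_sub, Finset.mul_sum, mul_comm a]
      simp only [Nat.cast_zero, zero_mul, zero_div, add_zero]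
      congr 1
      refine Finset.sum_congr rfl fun k _ => ?_
      have h1 : (k.factorial : ℂ) ≠ 0 := by exact_mod_cast k.factorial_ne_zero
      have h2 : ((k : ℂ) + 1) ≠ 0 := by exact_mod_cast k.succ_ne_zero
      rw [Nat.factorial_succ, Nat.add_sub_cancel]
      push_cast
      field_simp
    have hB : ∀ x : ℝ, HasDerivAt (fun y : ℝ => (‖a‖ * y) ^ (N + 1) / ((N + 1).factorial : ℝ))
        (‖a‖ * ((‖a‖ * x) ^ N / (N.factorial : ℝ))) x := by
      intro x
      have hlin : HasDerivAt (fun y : ℝ => ‖a‖ * y) ‖a‖ x := by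
        simpa using (hasDerivAt_id x).const_mul ‖a‖
      convert! (hlin.fun_pow (N + 1)).div_const ((N + 1).factorial : ℝ) using 1
      rw [Nat.factorial_succ, Nat.add_sub_cancel]
      push_cast
      field_simp
    -- The derivative of the remainder of order `N + 1` is `a` times the remainder of order `N`, and
    -- the bounds are related in the same way, so the mean value inequality closes the induction.
    refine image_norm_le_of_norm_deriv_right_le_deriv_boundary
      (fun x _ => (hd x).continuousAt.continuousWithinAt) (fun x _ => (hd x).hasDerivWithinAt)
      (a := 0) (b := y) ?_ hB (fun x hx => ?_) (Set.right_mem_Icc.2 hy)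
    · simp [Finset.sum_range_succ']
    · rw [norm_mul]
      exact mul_le_mul_of_nonneg_left (ih hx.1) (norm_nonneg _)

theorem norm_exp_mul_I_sub_sum_le (x : ℝ) (N : ℕ) :
    ‖Complex.exp (x * Complex.I) -
      ∑ k ∈ Finset.range N, (x * Complex.I) ^ k / (k.factorial : ℂ)‖ ≤
      |x| ^ N / N.factorial := by
  have h := norm_exp_sub_sum_le_of_re_eq_zero (a := x * Complex.I) (by simp) N zero_le_one
  simpa using h

/-- The Taylor bound is integrated; an even order `2 * R` makes the absolute moment an ordinary one.
-/
theorem norm_charFun_sub_sum_moments_le (μ : Measure ℝ) [IsProbabilityMeasure μ]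
    (hμ : ∀ r : ℕ, Integrable (fun x : ℝ => x ^ r) μ) (t : ℝ) (R : ℕ) :
    ‖charFun μ t - ∑ k ∈ Finset.range (2 * R),
      (t * Complex.I) ^ k / (k.factorial : ℂ) * ((∫ x, x ^ k ∂μ : ℝ) : ℂ)‖ ≤
      |t| ^ (2 * R) / (2 * R).factorial * ∫ x, x ^ (2 * R) ∂μ := by
  have hint : ∀ k ∈ Finset.range (2 * R), Integrable
      (fun x : ℝ => (t * Complex.I) ^ k / (k.factorial : ℂ) * ((x ^ k : ℝ) : ℂ)) μ :=
    fun k _ => ((hμ k).ofReal (𝕜 := ℂ)).const_mul _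
  have hexp : Integrable (fun x : ℝ => Complex.exp (t * x * Complex.I)) μ := by
    refine Integrable.of_bound (C := 1) (by fun_prop) (Eventually.of_forall fun x => ?_)
    rw [← Complex.ofReal_mul, Complex.norm_exp_ofReal_mul_I]
  have hsum : ∑ k ∈ Finset.range (2 * R),
      (t * Complex.I) ^ k / (k.factorial : ℂ) * ((∫ x, x ^ k ∂μ : ℝ) : ℂ) =
      ∫ x : ℝ, ∑ k ∈ Finset.range (2 * R),
        (t * Complex.I) ^ k / (k.factorial : ℂ) * ((x ^ k : ℝ) : ℂ) ∂μ := by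
    rw [integral_finsetSum _ hint]
    refine Finset.sum_congr rfl fun k _ => ?_
    rw [integral_const_mul, ← integral_complex_ofReal]
  rw [charFun_apply_real, hsum, ← integral_sub hexp (integrable_finsetSum _ hint),
    ← integral_const_mul]
  refine norm_integral_le_of_norm_le ((hμ _).const_mul _) (Eventually.of_forall fun x => ?_)
  have h := norm_exp_mul_I_sub_sum_le (t * x) (2 * R)
  have heq : |t * x| ^ (2 * R) / (2 * R).factorial =
      |t| ^ (2 * R) / (2 * R).factorial * x ^ (2 * R) := by
    rw [abs_mul, mul_pow, (even_two_mul R).pow_abs x]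
    ring
  rw [← heq]
  refine (congrArg norm ?_).trans_le h
  rw [Complex.ofReal_mul]
  congr 1
  refine Finset.sum_congr rfl fun k _ => ?_
  push_cast
  ring

/-- **Method of moments**: if all moments converge to the moments of a measure whose even moments
do not grow too fast, then the measures converge weakly. -/
theorem tendsto_of_tendsto_moments {μs : ℕ → ProbabilityMeasure ℝ} {μ : ProbabilityMeasure ℝ}
    (hμs : ∀ n, ∀ r : ℕ, Integrable (fun x : ℝ => x ^ r) (μs n : Measure ℝ))
    (hμ : ∀ r : ℕ, Integrable (fun x : ℝ => x ^ r) (μ : Measure ℝ))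
    (hlim : ∀ r : ℕ, Tendsto (fun n => ∫ x, x ^ r ∂(μs n : Measure ℝ)) atTop
      (𝓝 (∫ x, x ^ r ∂(μ : Measure ℝ))))
    (hgrowth : ∀ t : ℝ, Tendsto (fun R : ℕ => |t| ^ (2 * R) / (2 * R).factorial *
      ∫ x, x ^ (2 * R) ∂(μ : Measure ℝ)) atTop (𝓝 0)) :
    Tendsto μs atTop (𝓝 μ) := by
  refine ProbabilityMeasure.tendsto_of_tendsto_charFun fun t => ?_
  refine Metric.tendsto_nhds.2 fun ε hε => ?_
  -- One order `R` serves all measures: the remainder for `μs n` converges to the remainder for `μ`,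
  -- hence is eventually below `ε / 3` too.
  obtain ⟨R, hR⟩ := ((hgrowth t).eventually_lt_const (show (0 : ℝ) < ε / 3 by positivity)).exists
  set b : ℝ := |t| ^ (2 * R) / (2 * R).factorial
  have h1 := ((hlim (2 * R)).const_mul b).eventually_lt_const hR
  have h2 : Tendsto (fun n => ∑ k ∈ Finset.range (2 * R),
      (t * Complex.I) ^ k / (k.factorial : ℂ) * ((∫ x, x ^ k ∂(μs n : Measure ℝ) : ℝ) : ℂ)) atTop
      (𝓝 (∑ k ∈ Finset.range (2 * R),
      (t * Complex.I) ^ k / (k.factorial : ℂ) * ((∫ x, x ^ k ∂(μ : Measure ℝ) : ℝ) : ℂ))) :=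
    tendsto_finsetSum _ fun k _ =>
      ((Complex.continuous_ofReal.tendsto _).comp (hlim k)).const_mul _
  have h3 := Metric.tendsto_nhds.1 h2 (ε / 3) (by positivity)
  filter_upwards [h1, h3] with n hn1 hn3
  have e1 := norm_charFun_sub_sum_moments_le (μs n : Measure ℝ) (hμs n) t R
  have e2 := norm_charFun_sub_sum_moments_le (μ : Measure ℝ) hμ t R
  rw [← dist_eq_norm] at e1 e2
  rw [dist_comm] at e2
  calc _ ≤ _ := dist_triangle4 _ _ _ _
    _ < ε / 3 + ε / 3 + ε / 3 :=
      add_lt_add (add_lt_add (e1.trans_lt hn1) hn3) (e2.trans_lt hR)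
    _ = ε := by ring

/-- The continuous function that cuts off `x ^ r` at `-K` and `K`. -/
noncomputable def truncPow (r : ℕ) (K : ℕ) : BoundedContinuousFunction ℝ ℝ :=
  BoundedContinuousFunction.ofNormedAddCommGroup (fun x => max (-(K : ℝ)) (min (x ^ r) K))
    (by fun_prop) K (fun x => by
      have : (0 : ℝ) ≤ K := K.cast_nonneg
      rw [Real.norm_eq_abs, abs_le]
      exact ⟨le_max_left _ _, max_le (by linarith) (min_le_right _ _)⟩)

theorem truncPow_apply (r K : ℕ) (x : ℝ) :
    truncPow r K x = max (-(K : ℝ)) (min (x ^ r) K) := rfl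

/-- The cut-off only acts where `K < |x ^ r|`, and there `|x ^ r| ≤ x ^ (2 * r) / K`. This gives an
error uniform over measures with bounded moment of order `2 * r`. -/
theorem abs_truncPow_sub_le (r K : ℕ) (hK : 0 < K) (x : ℝ) :
    |truncPow r K x - x ^ r| ≤ (K : ℝ)⁻¹ * x ^ (2 * r) := by
  have hK' : (0 : ℝ) < K := Nat.cast_pos.2 hK
  rw [truncPow_apply, pow_mul', inv_mul_eq_div, le_div_iff₀ hK']
  generalize x ^ r = y
  rcases le_total y K with h1 | h1
  · rw [min_eq_left h1]
    rcases le_total (-(K : ℝ)) y with h2 | h2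
    · rw [max_eq_right h2]
      simpa using sq_nonneg y
    · rw [max_eq_left h2, abs_of_nonneg (by linarith)]
      nlinarith
  · rw [min_eq_right h1, max_eq_right (by linarith), abs_of_nonpos (by linarith)]
    nlinarith

theorem abs_truncPow_le (r K : ℕ) (x : ℝ) : |truncPow r K x| ≤ |x ^ r| := by
  have hK : (0 : ℝ) ≤ K := K.cast_nonneg
  rw [truncPow_apply, abs_le]
  have h1 := neg_abs_le (x ^ r)
  have h2 := le_abs_self (x ^ r)
  constructor
  · exact (le_min h1 ((neg_nonpos.2 (abs_nonneg _)).trans hK)).trans (le_max_right _ _)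
  · exact max_le ((neg_nonpos.2 hK).trans (abs_nonneg _)) ((min_le_left _ _).trans h2)

theorem tendsto_truncPow (r : ℕ) (x : ℝ) :
    Tendsto (fun K : ℕ => truncPow r K x) atTop (𝓝 (x ^ r)) := by
  obtain ⟨N, hN⟩ := exists_nat_ge |x ^ r|
  refine tendsto_const_nhds.congr' ?_
  filter_upwards [eventually_ge_atTop N] with K hK
  have hK' : |x ^ r| ≤ K := hN.trans (Nat.cast_le.2 hK)
  rw [truncPow_apply, min_eq_left (abs_le.1 hK').2, max_eq_right (abs_le.1 hK').1]

variable {ι : Type*} {F : Filter ι} [F.NeBot] {μs : ι → ProbabilityMeasure ℝ}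
  {μ : ProbabilityMeasure ℝ} {c : ℕ → ℝ}

/-- Weak convergence bounds the integrals of the truncated even powers by `c (2 * r)`; Fatou's lemma
removes the truncation. -/
theorem integrable_pow_two_mul_of_tendsto (hμs : Tendsto μs F (𝓝 μ))
    (hint : ∀ᶠ i in F, ∀ r : ℕ, Integrable (fun x : ℝ => x ^ r) (μs i : Measure ℝ))
    (hlim : ∀ r : ℕ, Tendsto (fun i => ∫ x, x ^ r ∂(μs i : Measure ℝ)) F (𝓝 (c r))) (r : ℕ) :
    Integrable (fun x : ℝ => x ^ (2 * r)) (μ : Measure ℝ) := by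
  have hpos (K : ℕ) (x : ℝ) : 0 ≤ truncPow (2 * r) K x := by
    rw [truncPow_apply]
    exact le_max_of_le_right (le_min ((even_two_mul r).pow_nonneg x) K.cast_nonneg)
  have hbd (K : ℕ) : ∫ x, truncPow (2 * r) K x ∂(μ : Measure ℝ) ≤ c (2 * r) := by
    refine le_of_tendsto_of_tendsto
      (ProbabilityMeasure.tendsto_iff_forall_integral_tendsto.1 hμs (truncPow (2 * r) K))
      (hlim (2 * r)) ?_
    filter_upwards [hint] with i hi
    refine integral_mono ((truncPow (2 * r) K).integrable _) (hi _) fun x => ?_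
    exact ((le_abs_self _).trans (abs_truncPow_le _ _ _)).trans_eq
      (abs_of_nonneg ((even_two_mul r).pow_nonneg x))
  refine ⟨by fun_prop, ?_⟩
  rw [hasFiniteIntegral_iff_ofReal
    (Eventually.of_forall fun x => (even_two_mul r).pow_nonneg x)]
  have hle := lintegral_liminf_le' (μ := (μ : Measure ℝ)) (u := atTop)
    (f := fun (K : ℕ) x => ENNReal.ofReal (truncPow (2 * r) K x))
    (fun K => (truncPow (2 * r) K).continuous.measurable.ennreal_ofReal.aemeasurable)
  have heq : ∀ x : ℝ, liminf (fun K : ℕ => ENNReal.ofReal (truncPow (2 * r) K x)) atTop =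
      ENNReal.ofReal (x ^ (2 * r)) := fun x =>
    ((ENNReal.continuous_ofReal.tendsto _).comp (tendsto_truncPow (2 * r) x)).liminf_eq
  simp only [heq] at hle
  refine hle.trans_lt (lt_of_le_of_lt ?_ (ENNReal.ofReal_lt_top (r := c (2 * r))))
  refine liminf_le_of_le (h := fun b hb => ?_)
  obtain ⟨K, hK⟩ := hb.exists
  refine hK.trans ?_
  rw [← ofReal_integral_eq_lintegral_ofReal ((truncPow (2 * r) K).integrable _)
    (Eventually.of_forall (hpos K))]
  exact ENNReal.ofReal_le_ofReal (hbd K)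

theorem integrable_pow_of_tendsto (hμs : Tendsto μs F (𝓝 μ))
    (hint : ∀ᶠ i in F, ∀ r : ℕ, Integrable (fun x : ℝ => x ^ r) (μs i : Measure ℝ))
    (hlim : ∀ r : ℕ, Tendsto (fun i => ∫ x, x ^ r ∂(μs i : Measure ℝ)) F (𝓝 (c r))) (r : ℕ) :
    Integrable (fun x : ℝ => x ^ r) (μ : Measure ℝ) := by
  refine ((integrable_const (1 : ℝ)).add
    (integrable_pow_two_mul_of_tendsto hμs hint hlim r)).mono' (by fun_prop)
    (Eventually.of_forall fun x => ?_)
  rw [Real.norm_eq_abs, Pi.add_apply, pow_mul', ← sq_abs (x ^ r)]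
  nlinarith [sq_nonneg (|x ^ r| - 1), abs_nonneg (x ^ r)]

/-- The limits in `i` and `K` are interchanged: the truncation error is at most `c (2 * r) / K` in
the limit along `F`, and dominated convergence treats `μ`. -/
theorem integral_pow_eq_of_tendsto (hμs : Tendsto μs F (𝓝 μ))
    (hint : ∀ᶠ i in F, ∀ r : ℕ, Integrable (fun x : ℝ => x ^ r) (μs i : Measure ℝ))
    (hlim : ∀ r : ℕ, Tendsto (fun i => ∫ x, x ^ r ∂(μs i : Measure ℝ)) F (𝓝 (c r))) (r : ℕ) :
    ∫ x, x ^ r ∂(μ : Measure ℝ) = c r := by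
  have hr := integrable_pow_of_tendsto hμs hint hlim r
  have h1 : Tendsto (fun K : ℕ => ∫ x, truncPow r K x ∂(μ : Measure ℝ)) atTop
      (𝓝 (∫ x, x ^ r ∂(μ : Measure ℝ))) :=
    tendsto_integral_of_dominated_convergence _
      (fun K => (truncPow r K).continuous.aestronglyMeasurable) hr.abs
      (fun K => Eventually.of_forall (abs_truncPow_le r K))
      (Eventually.of_forall (tendsto_truncPow r))
  have h2 : ∀ᶠ K : ℕ in atTop,
      |∫ x, truncPow r K x ∂(μ : Measure ℝ) - c r| ≤ (K : ℝ)⁻¹ * c (2 * r) := by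
    filter_upwards [eventually_gt_atTop 0] with K hK
    refine le_of_tendsto_of_tendsto
      ((ProbabilityMeasure.tendsto_iff_forall_integral_tendsto.1 hμs (truncPow r K)).sub
        (hlim r)).abs ((hlim (2 * r)).const_mul _) ?_
    filter_upwards [hint] with i hi
    rw [← integral_sub ((truncPow r K).integrable _) (hi r), ← integral_const_mul]
    exact norm_integral_le_of_norm_le (f := fun x => truncPow r K x - x ^ r)
      ((hi (2 * r)).const_mul _)
      (Eventually.of_forall (abs_truncPow_sub_le r K hK))
  have h3 : Tendsto (fun K : ℕ => (K : ℝ)⁻¹ * c (2 * r)) atTop (𝓝 0) := by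
    simpa using tendsto_inv_atTop_nhds_zero_nat.mul_const (c (2 * r))
  have h4 : Tendsto (fun K : ℕ => ∫ x, truncPow r K x ∂(μ : Measure ℝ)) atTop (𝓝 (c r)) := by
    rw [tendsto_iff_dist_tendsto_zero]
    exact squeeze_zero' (Eventually.of_forall fun _ => dist_nonneg) h2 h3
  exact tendsto_nhds_unique h1 h4

theorem isTightMeasureSet_of_integral_sq_le {S : Set (ProbabilityMeasure ℝ)} {B : ℝ}
    (hint : ∀ ν ∈ S, Integrable (fun x : ℝ => x ^ 2) (ν : Measure ℝ))
    (hB : ∀ ν ∈ S, ∫ x, x ^ 2 ∂(ν : Measure ℝ) ≤ B) :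
    IsTightMeasureSet {((ν : ProbabilityMeasure ℝ) : Measure ℝ) | ν ∈ S} := by
  refine isTightMeasureSet_of_tendsto_measure_norm_gt ?_
  have hlim : Tendsto (fun R : ℝ => ENNReal.ofReal (B / R ^ 2)) atTop (𝓝 0) := by
    rw [← ENNReal.ofReal_zero]
    exact (ENNReal.continuous_ofReal.tendsto _).comp
      (tendsto_const_nhds.div_atTop (tendsto_pow_atTop two_ne_zero))
  refine tendsto_of_tendsto_of_tendsto_of_le_of_le' tendsto_const_nhds hlim
    (Eventually.of_forall fun _ => zero_le) ?_
  filter_upwards [eventually_gt_atTop 0] with R hR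
  refine iSup₂_le ?_
  rintro _ ⟨ν, hν, rfl⟩
  have hmar := mul_meas_ge_le_integral_of_nonneg (μ := (ν : Measure ℝ))
    (Eventually.of_forall fun x : ℝ => sq_nonneg x) (hint ν hν) (R ^ 2)
  have hsub : {x : ℝ | R < ‖x‖} ⊆ {x | R ^ 2 ≤ x ^ 2} := by
    intro x hx
    have hx' : R < |x| := hx
    show R ^ 2 ≤ x ^ 2
    rw [← sq_abs x]
    gcongr
  have hle : (ν : Measure ℝ).real {x | R ^ 2 ≤ x ^ 2} ≤ B / R ^ 2 := by
    rw [le_div_iff₀ (by positivity), mul_comm]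
    exact hmar.trans (hB ν hν)
  calc (ν : Measure ℝ) {x : ℝ | R < ‖x‖} ≤ (ν : Measure ℝ) {x | R ^ 2 ≤ x ^ 2} :=
        measure_mono hsub
    _ = ENNReal.ofReal ((ν : Measure ℝ).real {x | R ^ 2 ≤ x ^ 2}) :=
        (ofReal_measureReal (measure_ne_top _ _)).symm
    _ ≤ _ := ENNReal.ofReal_le_ofReal hle

/-- If all moments of a sequence of probability measures converge, then the limits are the moments
of a probability measure. -/
theorem exists_moments_eq_of_tendsto {νs : ℕ → ProbabilityMeasure ℝ}
    (hint : ∀ n, ∀ r : ℕ, Integrable (fun x : ℝ => x ^ r) (νs n : Measure ℝ))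
    (hlim : ∀ r : ℕ, Tendsto (fun n => ∫ x, x ^ r ∂(νs n : Measure ℝ)) atTop (𝓝 (c r))) :
    ∃ ν : ProbabilityMeasure ℝ, ∀ r : ℕ, Integrable (fun x : ℝ => x ^ r) (ν : Measure ℝ) ∧
      ∫ x, x ^ r ∂(ν : Measure ℝ) = c r := by
  obtain ⟨B, hB⟩ := (hlim 2).bddAbove_range
  have htight := isTightMeasureSet_of_integral_sq_le (S := Set.range νs) (B := B)
    (by rintro _ ⟨n, rfl⟩; exact hint n 2) (by rintro _ ⟨n, rfl⟩; exact hB ⟨n, rfl⟩)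
  -- Tightness follows from the bounded second moments. By compactness the sequence converges along
  -- a free ultrafilter, which replaces a subsequence.
  obtain ⟨ν, -, hν⟩ := (isCompact_closure_of_isTightMeasureSet htight).ultrafilter_le_nhds
    ((hyperfilter ℕ).map νs) (by
      rw [le_principal_iff]
      exact mem_of_superset (range_mem_map) subset_closure)
  have hle : (hyperfilter ℕ : Filter ℕ) ≤ atTop := by
    rw [← Nat.cofinite_eq_atTop]; exact hyperfilter_le_cofinite
  have hν' : Tendsto νs (hyperfilter ℕ : Filter ℕ) (𝓝 ν) := hν
  exact ⟨ν, fun r => ⟨integrable_pow_of_tendsto hν' (Eventually.of_forall hint)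
    (fun r => (hlim r).mono_left hle) r,
    integral_pow_eq_of_tendsto hν' (Eventually.of_forall hint)
    (fun r => (hlim r).mono_left hle) r⟩⟩

end MethodOfMoments

/-! ### Moments of the path length and the Mittag-Leffler limit. -/

theorem lengthProb_eq_zero (p : ℝ) {n m : ℕ} (h : n + 1 < m) : lengthProb p n m = 0 := by
  induction n generalizing m with
  | zero => rw [lengthProb, if_neg (by omega)]
  | succ n ih =>
    obtain ⟨m, rfl⟩ := Nat.exists_eq_add_of_le' (show 1 ≤ m by omega)
    rw [lengthProb, ih (by omega), ih (by omega)]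
    simp

/-- The expectation of a function of the length of a source-to-sink path in the random network of
size `n + 1`. -/
noncomputable def lengthMean (p : ℝ) (n : ℕ) (φ : ℕ → ℝ) : ℝ :=
  ∑ m ∈ Finset.range (n + 2), lengthProb p n m * φ m

theorem lengthMean_sub (p : ℝ) (n : ℕ) (φ χ : ℕ → ℝ) :
    lengthMean p n (fun m => φ m - χ m) = lengthMean p n φ - lengthMean p n χ := by
  simp only [lengthMean, mul_sub, Finset.sum_sub_distrib]

theorem lengthMean_const_mul (p : ℝ) (n : ℕ) (a : ℝ) (φ : ℕ → ℝ) :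
    lengthMean p n (fun m => a * φ m) = a * lengthMean p n φ := by
  simp only [lengthMean, Finset.mul_sum]
  exact Finset.sum_congr rfl fun m _ => by ring

theorem lengthMean_succ (p : ℝ) (n : ℕ) (φ : ℕ → ℝ) :
    lengthMean p (n + 1) φ =
      lengthMean p n fun m => φ m + (1 - p) / (n + 1) * (m * (φ (m + 1) - φ m)) := by
  -- The index shift loses no mass: lengths `0` and `n + 2` have probability zero at size `n + 1`.
  have h0 : ∑ m ∈ Finset.range (n + 2),
      (1 - (1 - p) * (m + 1) / (n + 1)) * lengthProb p n (m + 1) * φ (m + 1) =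
      ∑ m ∈ Finset.range (n + 2), (1 - (1 - p) * m / (n + 1)) * lengthProb p n m * φ m := by
    have h := Finset.sum_range_succ' (fun m : ℕ =>
      (1 - (1 - p) * m / (n + 1)) * lengthProb p n m * φ m) (n + 2)
    rw [Finset.sum_range_succ, lengthProb_eq_zero p (show n + 1 < n + 2 by omega),
      lengthProb_zero_right] at h
    simpa using h.symm
  rw [lengthMean, Finset.sum_range_succ', lengthProb_zero_right, zero_mul, add_zero]
  simp only [lengthProb, add_mul, Finset.sum_add_distrib]
  rw [h0, lengthMean, ← Finset.sum_add_distrib]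
  exact Finset.sum_congr rfl fun m _ => by ring

/-- The rising factorial `φ` satisfies `m * (φ (m + 1) - φ m) = r * φ m`, so each step multiplies
its mean by a constant. The initial value `r!` is the rising factorial of `1`. -/
theorem lengthMean_ascPochhammer (p : ℝ) (n r : ℕ) :
    lengthMean p n (fun m => (ascPochhammer ℝ r).eval (m : ℝ)) =
      r.factorial * ∏ k ∈ Finset.range n, (1 + r * (1 - p) / (k + 1)) := by
  induction n with
  | zero => simp [lengthMean, lengthProb, ascPochhammer_eval_one]
  | succ n ih =>
    have key (m : ℕ) : (m : ℝ) * ((ascPochhammer ℝ r).eval ((m + 1 : ℕ) : ℝ) -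
        (ascPochhammer ℝ r).eval (m : ℝ)) = r * (ascPochhammer ℝ r).eval (m : ℝ) := by
      have h1 := ascPochhammer_succ_eval r (m : ℝ)
      rw [ascPochhammer_succ_left, Polynomial.eval_mul, Polynomial.eval_comp] at h1
      simp only [Polynomial.eval_X, Polynomial.eval_add, Polynomial.eval_one] at h1
      push_cast
      linear_combination h1
    rw [lengthMean_succ, Finset.prod_range_succ, ← mul_assoc, ← ih, mul_comm,
      ← lengthMean_const_mul]
    congr 1
    ext m
    rw [key]
    ring

theorem tendsto_prod_div_rpow {s : ℝ} (hs : 0 ≤ s) :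
    Tendsto (fun n : ℕ => (∏ k ∈ Finset.range n, (1 + s / (k + 1))) / ((n : ℝ) + 1) ^ s) atTop
      (𝓝 (1 / Real.Gamma (s + 1))) := by
  rcases hs.eq_or_lt with rfl | hs
  · simp
  have h1 : Tendsto (fun n : ℕ => Real.GammaSeq s (n + 1)) atTop (𝓝 (Real.Gamma s)) :=
    (tendsto_add_atTop_iff_nat 1).2 (Real.GammaSeq_tendsto_Gamma s)
  have h2 : Tendsto (fun n : ℕ => (((n + 1 : ℕ) : ℝ)) / ((n + 1 : ℕ) + s)) atTop (𝓝 1) :=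
    (tendsto_add_atTop_iff_nat 1).2 (tendsto_natCast_div_add_atTop s)
  have hΓ := (Real.Gamma_pos_of_pos hs).ne'
  -- Euler's product in `GammaSeq s (n + 1)` has the extra factors `s` and `s + n + 1`: `s` turns
  -- `Γ(s)` into `Γ(s + 1)`, and `h2` compensates the other one.
  have h3 := h2.div (h1.const_mul s) (mul_ne_zero hs.ne' hΓ)
  rw [← Real.Gamma_add_one hs.ne'] at h3
  refine h3.congr fun n => ?_
  have hprod : ∏ k ∈ Finset.range n, (1 + s / ((k : ℝ) + 1)) =
      (∏ k ∈ Finset.range n, (s + ((k + 1 : ℕ) : ℝ))) / n.factorial := by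
    rw [← Finset.prod_range_add_one_eq_factorial, Nat.cast_prod, ← Finset.prod_div_distrib]
    refine Finset.prod_congr rfl fun k _ => ?_
    have : (k : ℝ) + 1 ≠ 0 := by positivity
    push_cast
    field_simp
    ring
  have hpos : ∏ k ∈ Finset.range n, (s + ((k + 1 : ℕ) : ℝ)) ≠ 0 :=
    (Finset.prod_pos fun k _ => by positivity).ne'
  rw [hprod, Pi.div_apply, Real.GammaSeq, Finset.prod_range_succ, Finset.prod_range_succ',
    Nat.factorial_succ]
  have e1 : ((n : ℝ) + 1) ^ s ≠ 0 := (Real.rpow_pos_of_pos (by positivity) _).ne'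
  have e2 : (n.factorial : ℝ) ≠ 0 := by positivity
  have e3 : s + ((n : ℝ) + 1) ≠ 0 := by positivity
  have e4 : (n : ℝ) + 1 ≠ 0 := by positivity
  have e5 : (n : ℝ) + 1 + s ≠ 0 := by positivity
  push_cast at hpos ⊢
  field_simp
  ring

/-- Mixed products let rising factors be traded for plain powers one at a time; each trade costs a
term of lower order, which vanishes after scaling. -/
theorem tendsto_lengthMean_pow_mul_ascPochhammer {p : ℝ} (hp : p ∈ Set.Ioo (0 : ℝ) 1) (j r : ℕ) :
    Tendsto (fun n : ℕ => lengthMean p n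
        (fun m => (m : ℝ) ^ j * (ascPochhammer ℝ r).eval (m : ℝ)) /
        (((n : ℝ) + 1) ^ (1 - p)) ^ (j + r)) atTop
      (𝓝 (((j + r).factorial : ℝ) / Real.Gamma ((j + r : ℕ) * (1 - p) + 1))) := by
  have hα : 0 < 1 - p := sub_pos.2 hp.2
  induction j generalizing r with
  | zero =>
    have h := (tendsto_prod_div_rpow (s := r * (1 - p)) (by positivity)).const_mul
      (r.factorial : ℝ)
    simp only [pow_zero, one_mul, zero_add, lengthMean_ascPochhammer]
    rw [mul_one_div] at h
    refine h.congr fun n => ?_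
    rw [← Real.rpow_natCast (((n : ℝ) + 1) ^ (1 - p)), ← Real.rpow_mul (by positivity),
      mul_comm (1 - p), mul_div_assoc]
  | succ j ih =>
    have hinv : Tendsto (fun n : ℕ => (r : ℝ) * (((n : ℝ) + 1) ^ (1 - p))⁻¹) atTop (𝓝 0) := by
      have h : Tendsto (fun n : ℕ => ((n : ℝ) + 1) ^ (1 - p)) atTop atTop :=
        (tendsto_rpow_atTop hα).comp
          (tendsto_atTop_add_const_right _ _ tendsto_natCast_atTop_atTop)
      simpa using h.inv_tendsto_atTop.const_mul (r : ℝ)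
    have h := (ih (r + 1)).sub (hinv.mul (ih r))
    rw [zero_mul, sub_zero] at h
    rw [show j + 1 + r = j + (r + 1) by ring]
    refine h.congr fun n => ?_
    have hfun : (fun m : ℕ => (m : ℝ) ^ (j + 1) * (ascPochhammer ℝ r).eval (m : ℝ)) = fun m : ℕ =>
        (m : ℝ) ^ j * (ascPochhammer ℝ (r + 1)).eval (m : ℝ) -
          r * ((m : ℝ) ^ j * (ascPochhammer ℝ r).eval (m : ℝ)) := by
      ext m
      rw [ascPochhammer_succ_eval]
      ring
    have e1 : ((n : ℝ) + 1) ^ (1 - p) ≠ 0 := (Real.rpow_pos_of_pos (by positivity) _).ne'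
    rw [hfun, lengthMean_sub, lengthMean_const_mul]
    generalize ((n : ℝ) + 1) ^ (1 - p) = a at e1
    field_simp
    ring

theorem tendsto_lengthMean_pow {p : ℝ} (hp : p ∈ Set.Ioo (0 : ℝ) 1) (r : ℕ) :
    Tendsto (fun n : ℕ => lengthMean p n (fun m => ((m : ℝ) / ((n : ℝ) + 1) ^ (1 - p)) ^ r)) atTop
      (𝓝 ((r.factorial : ℝ) / Real.Gamma (r * (1 - p) + 1))) := by
  have h := tendsto_lengthMean_pow_mul_ascPochhammer hp r 0
  simp only [add_zero, ascPochhammer_zero, Polynomial.eval_one, mul_one] at h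
  refine h.congr fun n => ?_
  rw [div_eq_inv_mul, ← lengthMean_const_mul]
  congr 1
  ext m
  rw [div_pow, div_eq_inv_mul]

theorem ae_pathLengthLaw_le {p : ℝ} (hp : p ∈ Set.Ioo (0 : ℝ) 1) (n : ℕ) :
    ∀ᵐ k ∂(pathLengthLaw hp (n + 1)).toMeasure, k ∈ Finset.range (n + 2) := by
  rw [ae_iff, PMF.toMeasure_apply_eq_zero_iff _ (MeasurableSet.of_discrete),
    Set.disjoint_left]
  intro k hk hk'
  have hk'' : n + 1 < k := not_lt.1 fun h => hk' (Finset.mem_range.2 h)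
  refine (PMF.mem_support_iff _ _).1 hk ?_
  have h := pathLengthLaw_toReal hp n k
  rw [lengthProb_eq_zero p hk'', ENNReal.toReal_eq_zero_iff] at h
  exact h.resolve_right (PMF.apply_ne_top _ _)

theorem integrable_pathLengthLaw {p : ℝ} (hp : p ∈ Set.Ioo (0 : ℝ) 1) (n : ℕ) (φ : ℕ → ℝ) :
    Integrable φ (pathLengthLaw hp (n + 1)).toMeasure := by
  refine Integrable.of_bound (C := ∑ m ∈ Finset.range (n + 2), ‖φ m‖) (by fun_prop) ?_
  filter_upwards [ae_pathLengthLaw_le hp n] with k hk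
  exact Finset.single_le_sum (f := fun m => ‖φ m‖) (fun _ _ => norm_nonneg _) hk

theorem integral_pathLengthLaw {p : ℝ} (hp : p ∈ Set.Ioo (0 : ℝ) 1) (n : ℕ) (φ : ℕ → ℝ) :
    ∫ k, φ k ∂(pathLengthLaw hp (n + 1)).toMeasure = lengthMean p n φ := by
  rw [PMF.integral_eq_tsum _ _ (integrable_pathLengthLaw hp n φ), lengthMean,
    tsum_eq_sum (s := Finset.range (n + 2))]
  · simp only [pathLengthLaw_toReal, smul_eq_mul]
  · intro m hm
    rw [pathLengthLaw_toReal, lengthProb_eq_zero p (not_lt.1 fun h => hm (Finset.mem_range.2 h)),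
      zero_smul]

theorem scaledLengthLaw_eq_map {p : ℝ} (hp : p ∈ Set.Ioo (0 : ℝ) 1) (n : ℕ) :
    (scaledLengthLaw hp n : Measure ℝ) =
      (pathLengthLaw hp n).toMeasure.map fun k : ℕ => (k : ℝ) / (n : ℝ) ^ (1 - p) := by
  have hm : Measurable fun k : ℕ => (k : ℝ) / (n : ℝ) ^ (1 - p) := measurable_of_countable _
  -- The scaled law is a push-forward in two stages, from `ℕ` to `ℝ` and then by the scaling; they
  -- are merged into one.
  change (PMF.map (fun x : ℝ => x / (n : ℝ) ^ (1 - p))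
    ((pathLengthLaw hp n).bind (PMF.pure ∘ fun k : ℕ => (k : ℝ)))).toMeasure = _
  rw [PMF.bind_pure_comp, PMF.map_comp, PMF.toMeasure_map _ _ hm]
  rfl

theorem integrable_pow_scaledLengthLaw {p : ℝ} (hp : p ∈ Set.Ioo (0 : ℝ) 1) (n r : ℕ) :
    Integrable (fun x : ℝ => x ^ r) (scaledLengthLaw hp (n + 1) : Measure ℝ) := by
  rw [scaledLengthLaw_eq_map, integrable_map_measure (by fun_prop) (by fun_prop)]
  exact integrable_pathLengthLaw hp n _

theorem integral_pow_scaledLengthLaw {p : ℝ} (hp : p ∈ Set.Ioo (0 : ℝ) 1) (n r : ℕ) :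
    ∫ x, x ^ r ∂(scaledLengthLaw hp (n + 1) : Measure ℝ) =
      lengthMean p n fun m => ((m : ℝ) / ((n : ℝ) + 1) ^ (1 - p)) ^ r := by
  rw [scaledLengthLaw_eq_map, integral_map (by fun_prop) (by fun_prop), integral_pathLengthLaw,
    Nat.cast_succ]

/-- Restrict Euler's integral to `x > c`, where `x ^ s ≥ c ^ s`. -/
theorem rpow_mul_exp_neg_le_Gamma {c s : ℝ} (hc : 0 < c) (hs : 0 ≤ s) :
    c ^ s * Real.exp (-c) ≤ Real.Gamma (s + 1) := by
  have hint := Real.GammaIntegral_convergent (s := s + 1) (by linarith)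
  rw [Real.Gamma_eq_integral (by linarith), ← integral_exp_neg_Ioi c, ← integral_const_mul]
  refine le_trans ?_ (setIntegral_mono_set hint ?_ (Set.Ioi_subset_Ioi hc.le).eventuallyLE)
  · refine setIntegral_mono_on ((integrableOn_exp_neg_Ioi c).const_mul _)
      (hint.mono_set (Set.Ioi_subset_Ioi hc.le)) measurableSet_Ioi fun x hx => ?_
    rw [add_sub_cancel_right, mul_comm]
    exact mul_le_mul_of_nonneg_left (Real.rpow_le_rpow hc.le (le_of_lt hx) hs)
      (Real.exp_pos _).le
  · filter_upwards [ae_restrict_mem measurableSet_Ioi] with x hx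
    exact mul_nonneg (Real.exp_pos _).le (Real.rpow_nonneg (le_of_lt hx) _)

theorem tendsto_pow_div_Gamma {α : ℝ} (hα : 0 < α) (t : ℝ) :
    Tendsto (fun R : ℕ => |t| ^ (2 * R) / Real.Gamma ((2 * R : ℕ) * α + 1)) atTop (𝓝 0) := by
  set b : ℝ := 2 * |t| + 1
  have hb : 0 < b := by positivity
  set c : ℝ := b ^ α⁻¹
  have hc : 0 < c := Real.rpow_pos_of_pos hb _
  have hq : (|t| / b) ^ 2 < 1 := by
    refine pow_lt_one₀ (by positivity) ?_ two_ne_zero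
    rw [div_lt_one hb]
    have := abs_nonneg t
    simp only [b]
    linarith
  have hlim : Tendsto (fun R : ℕ => Real.exp c * ((|t| / b) ^ 2) ^ R) atTop (𝓝 0) := by
    simpa using (tendsto_pow_atTop_nhds_zero_of_lt_one (sq_nonneg _) hq).const_mul (Real.exp c)
  refine squeeze_zero (fun R => ?_) (fun R => ?_) hlim
  · exact div_nonneg (by positivity) (Real.Gamma_pos_of_pos (by positivity)).le
  · have h := rpow_mul_exp_neg_le_Gamma hc (s := (2 * R : ℕ) * α) (by positivity)
    have hcb : c ^ ((2 * R : ℕ) * α) = b ^ (2 * R) := by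
      rw [← Real.rpow_mul hb.le, mul_comm ((2 * R : ℕ) : ℝ), ← mul_assoc,
        inv_mul_cancel₀ hα.ne', one_mul, Real.rpow_natCast]
    rw [hcb, Real.exp_neg] at h
    calc |t| ^ (2 * R) / Real.Gamma ((2 * R : ℕ) * α + 1)
        ≤ |t| ^ (2 * R) / (b ^ (2 * R) * (Real.exp c)⁻¹) := by gcongr
      _ = Real.exp c * ((|t| / b) ^ 2) ^ R := by
        rw [← pow_mul, div_pow]
        field_simp

theorem exists_isMittagLeffler {p : ℝ} (hp : p ∈ Set.Ioo (0 : ℝ) 1) :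
    ∃ μ : ProbabilityMeasure ℝ, IsMittagLeffler (1 - p) μ :=
  exists_moments_eq_of_tendsto (νs := fun n => scaledLengthLaw hp (n + 1))
    (integrable_pow_scaledLengthLaw hp) fun r => by
      simpa only [integral_pow_scaledLengthLaw] using tendsto_lengthMean_pow hp r

theorem tendsto_scaledLengthLaw {p : ℝ} (hp : p ∈ Set.Ioo (0 : ℝ) 1) {μ : ProbabilityMeasure ℝ}
    (hμ : IsMittagLeffler (1 - p) μ) :
    Tendsto (fun n : ℕ => scaledLengthLaw hp n) atTop (𝓝 μ) := by
  refine (tendsto_add_atTop_iff_nat 1).1 (tendsto_of_tendsto_moments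
    (integrable_pow_scaledLengthLaw hp) (fun r => (hμ r).1) (fun r => ?_) fun t => ?_)
  · simpa only [integral_pow_scaledLengthLaw, (hμ r).2] using tendsto_lengthMean_pow hp r
  · refine (tendsto_pow_div_Gamma (sub_pos.2 hp.2) t).congr fun R => ?_
    have : ((2 * R).factorial : ℝ) ≠ 0 := by positivity
    rw [(hμ (2 * R)).2]
    field_simp

end SeriesParallel

theorem mainTheorem3 (p : ℝ) (hp : p ∈ Set.Ioo (0 : ℝ) 1) :
    -- the random path and the leftmost path have equidistributed lengths
    (∀ n : ℕ, 1 ≤ n →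
      SeriesParallel.pathLengthLaw hp n = SeriesParallel.leftmostLengthLaw hp n) ∧
    -- the exact distribution of the length
    (∀ n m : ℕ, 1 ≤ m → m ≤ n →
      (SeriesParallel.pathLengthLaw hp n m).toReal =
        ∑ j ∈ Finset.range m, ((m - 1).choose j : ℝ) * (-1) ^ (n + j - 1) *
          Ring.choose ((j : ℝ) - p * ((j : ℝ) + 1)) (n - 1)) ∧
    -- the limiting distribution of the length
    ((∃ μ : ProbabilityMeasure ℝ, SeriesParallel.IsMittagLeffler (1 - p) μ) ∧
      ∀ μ : ProbabilityMeasure ℝ, SeriesParallel.IsMittagLeffler (1 - p) μ →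
        Tendsto (fun n : ℕ => SeriesParallel.scaledLengthLaw hp n) atTop (𝓝 μ)) ∧
    -- the joint distribution of the length and of the degree of the source
    (∀ n m l : ℕ, 1 ≤ m → m ≤ n → 1 ≤ l → l ≤ n →
      (SeriesParallel.lengthDegreeLaw hp n (m, l)).toReal =
        ∑ i ∈ Finset.range m, ∑ j ∈ Finset.range l,
          ((m - 1).choose i : ℝ) * ((l - 1).choose j : ℝ) * (-1) ^ (n + i + j - 1) *
            Ring.choose ((1 - p) * (i : ℝ) + p * (j : ℝ)) (n - 1)) :=
  ⟨fun n hn => by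
      obtain ⟨n, rfl⟩ := Nat.exists_eq_add_of_le' hn
      exact SeriesParallel.pathLengthLaw_eq_leftmostLengthLaw hp n,
    SeriesParallel.pathLengthLaw_toReal_eq_sum hp,
    ⟨SeriesParallel.exists_isMittagLeffler hp,
      fun _ hμ => SeriesParallel.tendsto_scaledLengthLaw hp hμ⟩,
    fun n m l hm hmn hl _ => SeriesParallel.lengthDegreeLaw_toReal_eq_sum hp n m l hm hmn hl⟩
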